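/- A quadric surface in Euclidean $3$-space $\mathbb{E}^3$ is the zero set $S$ of a real polynomial of degree two in three variables that contains a piece of a regular surface (so $S$ is not empty, a point or a line) and is not the union of two distinct planes; a single (double) plane is allowed. For a regular smooth local parametrization $\boldsymbol{x}(u,v)$ of a part of $S$ let $g_{ij}$ be the coefficients of the first fundamental form $I$, $g=\det(g_{ij})$, $(g^{ij})=(g_{ij})^{-1}$, let $$\boldsymbol{n}=\frac{\boldsymbol{x}_u\times\boldsymbol{x}_v}{|\boldsymbol{x}_u\times\boldsymbol{x}_v|}$$ be the Gauss map and let $$\Delta^I f=-\frac{1}{\sqrt g}\sum_{i,j}\partial_i\bigl(\sqrt g\,g^{ij}\,\partial_j f\bigr)$$ be the Laplace–Beltrami operator of $I$, applied to vector-valued functions componentwise. **Theorem.** Let $S$ be a quadric surface in $\mathbb{E}^3$. There is a constant matrix $\Lambda\in\mathbb{R}^{3\times 3}$ such that $\Delta^I\boldsymbol{n}=\Lambda\boldsymbol{n}$ in every regular local parametrization of $S$ if and only if $S$ is a plane, a circular cylinder or a sphere. -/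

import Mathlib

open scoped ContDiff

namespace QuadricGauss

noncomputable section

/-- Euclidean 3-space. -/
abbrev E3 : Type := EuclideanSpace ℝ (Fin 3)

/-- Partial derivative in the first parameter. -/
def du {V : Type*} [NormedAddCommGroup V] [NormedSpace ℝ V] (f : ℝ × ℝ → V) (p : ℝ × ℝ) : V :=
  fderiv ℝ f p (1, 0)

/-- Partial derivative in the second parameter. -/
def dv {V : Type*} [NormedAddCommGroup V] [NormedSpace ℝ V] (f : ℝ × ℝ → V) (p : ℝ × ℝ) : V :=
  fderiv ℝ f p (0, 1)

/-- Cross product of Euclidean 3-space. -/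
def cross (a b : E3) : E3 := WithLp.toLp 2 (crossProduct a.ofLp b.ofLp)

/-- A regular parametric representation `x = x(u, v)`, over the open set `U`, of a part of `S`. -/
structure IsRegularPatch (S : Set E3) (U : Set (ℝ × ℝ)) (x : ℝ × ℝ → E3) : Prop where
  isOpen : IsOpen U
  smooth : ContDiffOn ℝ ∞ x U
  regular : ∀ p ∈ U, cross (du x p) (dv x p) ≠ 0
  mapsTo : Set.MapsTo x U S

/-- The Gauss map `n = (x_u × x_v) / |x_u × x_v|` of a parametrized surface. -/
def gaussMap (x : ℝ × ℝ → E3) (p : ℝ × ℝ) : E3 :=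
  ‖cross (du x p) (dv x p)‖⁻¹ • cross (du x p) (dv x p)

/-- The coefficient `g₁₁` of the first fundamental form. -/
def g11 (x : ℝ × ℝ → E3) (p : ℝ × ℝ) : ℝ := inner ℝ (du x p) (du x p)

/-- The coefficient `g₁₂` of the first fundamental form. -/
def g12 (x : ℝ × ℝ → E3) (p : ℝ × ℝ) : ℝ := inner ℝ (du x p) (dv x p)

/-- The coefficient `g₂₂` of the first fundamental form. -/
def g22 (x : ℝ × ℝ → E3) (p : ℝ × ℝ) : ℝ := inner ℝ (dv x p) (dv x p)

/-- The discriminant `g = det (g_{ij})` of the first fundamental form. -/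
def gdet (x : ℝ × ℝ → E3) (p : ℝ × ℝ) : ℝ := g11 x p * g22 x p - g12 x p ^ 2

/-- The Laplace–Beltrami operator of the first fundamental form, with the geometers' sign:
`Δ f = -(1/√g) ∑ᵢⱼ ∂ᵢ (√g gⁱʲ ∂ⱼ f)`, where `(gⁱʲ)` is the inverse of `(g_{ij})`, that is
`g¹¹ = g₂₂ / g`, `g¹² = -g₁₂ / g`, `g²² = g₁₁ / g`. -/
def laplaceBeltrami (x : ℝ × ℝ → E3) (f : ℝ × ℝ → ℝ) (p : ℝ × ℝ) : ℝ :=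
  -(1 / √(gdet x p)) *
    (du (fun q => √(gdet x q) *
        ((g22 x q / gdet x q) * du f q + (-g12 x q / gdet x q) * dv f q)) p
      + dv (fun q => √(gdet x q) *
        ((-g12 x q / gdet x q) * du f q + (g11 x q / gdet x q) * dv f q)) p)

/-- The Gauss map `n` of `S` satisfies `Δ n = Λ n` (with `Δ` acting on each component of `n`), in
every regular parametric representation of a part of `S`, with the same matrix `Λ`. Reversing the
orientation replaces `n` by `-n` and does not affect the equation. -/
def GaussMapSatisfies (S : Set E3) (Λ : Matrix (Fin 3) (Fin 3) ℝ) : Prop :=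
  ∀ (U : Set (ℝ × ℝ)) (x : ℝ × ℝ → E3), IsRegularPatch S U x →
    ∀ p ∈ U, ∀ i : Fin 3,
      laplaceBeltrami x (fun q => gaussMap x q i) p = ∑ j : Fin 3, Λ i j * gaussMap x p j

/-- `S` is a plane. -/
def IsPlane (S : Set E3) : Prop :=
  ∃ (v : E3) (d : ℝ), v ≠ 0 ∧ S = {p | inner ℝ v p = d}

/-- `S` is a circular cylinder: the set of points at distance `r > 0` from the line through `a`
with unit direction `v`. -/
def IsCircularCylinder (S : Set E3) : Prop :=
  ∃ (a v : E3) (r : ℝ), ‖v‖ = 1 ∧ 0 < r ∧ S = {p | ‖(p - a) - (inner ℝ v (p - a) : ℝ) • v‖ = r}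

/-- `S` is a sphere. -/
def IsSphere (S : Set E3) : Prop :=
  ∃ (c : E3) (r : ℝ), 0 < r ∧ S = Metric.sphere c r

/-- `S` is the zero set of a real polynomial of degree two in three variables. -/
def IsQuadric (S : Set E3) : Prop :=
  ∃ (A : Matrix (Fin 3) (Fin 3) ℝ) (b : Fin 3 → ℝ) (c : ℝ), A.IsSymm ∧ A ≠ 0 ∧
    S = {p : E3 | (∑ i, ∑ j, A i j * p i * p j) + (∑ i, b i * p i) + c = 0}

/-- A quadric surface: a quadric that is two-dimensional (so not empty, a point or a line) and is
not a pair of distinct planes. -/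
structure IsQuadricSurface (S : Set E3) : Prop where
  isQuadric : IsQuadric S
  exists_patch : ∃ (U : Set (ℝ × ℝ)) (x : ℝ × ℝ → E3), U.Nonempty ∧ IsRegularPatch S U x
  not_pair_of_planes : ¬ ∃ P Q : Set E3, IsPlane P ∧ IsPlane Q ∧ P ≠ Q ∧ S = P ∪ Q

end

end QuadricGauss

namespace QuadricGauss

/-! Sufficiency. On a plane `n` is locally constant. On a sphere or a circular cylinder `n = ±P(x -
a)/r` with `P` the identity or the projection orthogonal to the axis, so each component of `n` is
locally an affine function of position. The Laplacian of such a function is a combination of `x_v ×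
n_u` and `n_v × x_u`, which gives `Δ n = (κ / r²) n` with `κ = 2` or `κ = 1`.

Necessity uses only the normal component of `Δ n = Λ n`. Since `|n| = 1`, this component is `|dn|²`,
the squared norm of the second fundamental form, so `|dn|² = ⟨n, Λ n⟩`. If the quadric is `F = 0`
with Hessian `D` and gradient `N = D p + b`, the second fundamental form is, up to sign, `D / |N|`
restricted to the tangent plane. Clearing denominators turns the equation into a polynomial identity
in `N` at the points of the quadric where `N ≠ 0` (`GaussMapSatisfies.quadPoly_identity`).

Restrict the identity to sections spanned by principal directions. Wherever `|N|²`, continued as a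
polynomial, vanishes, `⟨D N, N⟩` has to vanish too (`affine_eq_zero_of_identity`). This rules out
quadrics without a centre (`linear_part_eq_zero`) and makes the nonzero eigenvalues agree when the
centre is off the surface (`eigenvalue_eq`). If the centre is on the surface and the eigenvalues
have mixed signs, scaling along a ruling makes the third eigenvalue zero
(`cone_third_eigenvalue_eq_zero`). Among the remaining quadrics, parallel or crossing planes and
sets too thin to hold a patch are excluded by hypothesis. -/

/-! ### Cross products and unit normals. -/

lemma inner_eq_coord (a b : E3) : inner ℝ a b = a 0 * b 0 + a 1 * b 1 + a 2 * b 2 := by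
  simp [PiLp.inner_apply, Fin.sum_univ_three]; ring

lemma cross_zero (a b : E3) : cross a b 0 = a 1 * b 2 - a 2 * b 1 := by
  simp [cross, cross_apply]

lemma cross_one (a b : E3) : cross a b 1 = a 2 * b 0 - a 0 * b 2 := by
  simp [cross, cross_apply]

lemma cross_two (a b : E3) : cross a b 2 = a 0 * b 1 - a 1 * b 0 := by
  simp [cross, cross_apply]

lemma E3.ext_coord {a b : E3} (h0 : a 0 = b 0) (h1 : a 1 = b 1) (h2 : a 2 = b 2) : a = b := by
  ext i; fin_cases i <;> assumption

lemma cross_add_left (a b c : E3) : cross (a + b) c = cross a c + cross b c := by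
  simp [cross]

lemma cross_add_right (a b c : E3) : cross a (b + c) = cross a b + cross a c := by
  simp [cross]

lemma cross_sub_left (a b c : E3) : cross (a - b) c = cross a c - cross b c := by
  simp [cross]

lemma cross_sub_right (a b c : E3) : cross a (b - c) = cross a b - cross a c := by
  simp [cross]

lemma cross_smul_left (t : ℝ) (a b : E3) : cross (t • a) b = t • cross a b := by
  simp [cross]

lemma cross_smul_right (t : ℝ) (a b : E3) : cross a (t • b) = t • cross a b := by
  simp [cross]

lemma cross_swap (a b : E3) : cross a b = -cross b a := by
  refine E3.ext_coord ?_ ?_ ?_ <;> simp only [cross_zero, cross_one, cross_two, PiLp.neg_apply] <;>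
    ring

lemma cross_cross (a b c : E3) :
    cross a (cross b c) = (inner ℝ a c : ℝ) • b - (inner ℝ a b : ℝ) • c := by
  refine E3.ext_coord ?_ ?_ ?_ <;>
    simp only [cross_zero, cross_one, cross_two, inner_eq_coord, PiLp.sub_apply, PiLp.smul_apply,
      smul_eq_mul] <;> ring

lemma inner_cross_self_left (a b : E3) : inner ℝ a (cross a b) = (0 : ℝ) := by
  simp only [cross_zero, cross_one, cross_two, inner_eq_coord]; ring

lemma inner_cross_self_right (a b : E3) : inner ℝ b (cross a b) = (0 : ℝ) := by
  simp only [cross_zero, cross_one, cross_two, inner_eq_coord]; ring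

lemma norm_cross_sq (a b : E3) :
    ‖cross a b‖ ^ 2 = inner ℝ a a * inner ℝ b b - inner ℝ a b ^ 2 := by
  rw [← real_inner_self_eq_norm_sq]
  simp only [cross_zero, cross_one, cross_two, inner_eq_coord]; ring

lemma norm_cross_le (a b : E3) : ‖cross a b‖ ≤ ‖a‖ * ‖b‖ := by
  refine le_of_sq_le_sq ?_ (by positivity)
  rw [norm_cross_sq, real_inner_self_eq_norm_sq, real_inner_self_eq_norm_sq]
  nlinarith [sq_nonneg (inner ℝ a b : ℝ)]

/-- The cross product as a continuous bilinear map. -/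
noncomputable def crossL : E3 →L[ℝ] E3 →L[ℝ] E3 :=
  LinearMap.mkContinuous₂
    (LinearMap.mk₂ ℝ cross cross_add_left cross_smul_left cross_add_right cross_smul_right) 1
    (fun a b => by simpa using norm_cross_le a b)

@[simp] lemma crossL_apply (a b : E3) : crossL a b = cross a b := rfl

/-- A unit vector orthogonal to two independent vectors is one of their two unit normals. -/
lemma eq_smul_unit_normal {a b ν : E3} (hm : cross a b ≠ 0) (ha : inner ℝ ν a = (0 : ℝ))
    (hb : inner ℝ ν b = (0 : ℝ)) (hν : ‖ν‖ = 1) :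
    ‖cross a b‖⁻¹ • cross a b = (inner ℝ ν (‖cross a b‖⁻¹ • cross a b) : ℝ) • ν ∧
      (inner ℝ ν (‖cross a b‖⁻¹ • cross a b) : ℝ) ^ 2 = 1 := by
  have hc : cross ν (‖cross a b‖⁻¹ • cross a b) = 0 := by
    rw [cross_smul_right, cross_cross, ha, hb]; simp
  have hn : ‖‖cross a b‖⁻¹ • cross a b‖ = 1 := norm_smul_inv_norm hm
  set n := ‖cross a b‖⁻¹ • cross a b
  have h1 : (inner ℝ ν n : ℝ) ^ 2 = 1 := by
    have := norm_cross_sq ν n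
    rw [hc, real_inner_self_eq_norm_sq, real_inner_self_eq_norm_sq, hn, hν] at this
    simp at this; linarith
  refine ⟨?_, h1⟩
  -- Equality in Cauchy–Schwarz: the square expands to `1 - ⟨ν, n⟩²`.
  have : ‖n - (inner ℝ ν n : ℝ) • ν‖ ^ 2 = 0 := by
    rw [norm_sub_sq_real, inner_smul_right, hn, norm_smul, hν, real_inner_comm ν n]
    simp only [Real.norm_eq_abs, mul_one, sq_abs]; nlinarith
  exact sub_eq_zero.1 (norm_eq_zero.1 (pow_eq_zero_iff (two_ne_zero) |>.1 this))

lemma norm_gaussMap {x : ℝ × ℝ → E3} {p : ℝ × ℝ} (h : cross (du x p) (dv x p) ≠ 0) :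
    ‖gaussMap x p‖ = 1 := norm_smul_inv_norm h

lemma sqrt_gdet (x : ℝ × ℝ → E3) (p : ℝ × ℝ) : √(gdet x p) = ‖cross (du x p) (dv x p)‖ := by
  rw [gdet, g11, g22, g12, ← norm_cross_sq, Real.sqrt_sq (norm_nonneg _)]

lemma gdet_eq (x : ℝ × ℝ → E3) (p : ℝ × ℝ) : gdet x p = ‖cross (du x p) (dv x p)‖ ^ 2 := by
  rw [gdet, g11, g22, g12, ← norm_cross_sq]

/-! ### Calculus of the two partial derivatives. -/

section derivatives

variable {V W : Type*} [NormedAddCommGroup V] [NormedSpace ℝ V] [NormedAddCommGroup W]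
  [NormedSpace ℝ W]

lemma contDiffAt_du {f : ℝ × ℝ → V} {p : ℝ × ℝ} (hf : ContDiffAt ℝ ∞ f p) :
    ContDiffAt ℝ ∞ (du f) p :=
  (hf.fderiv_right (m := ∞) (by simp)).clm_apply contDiffAt_const

lemma contDiffAt_dv {f : ℝ × ℝ → V} {p : ℝ × ℝ} (hf : ContDiffAt ℝ ∞ f p) :
    ContDiffAt ℝ ∞ (dv f) p :=
  (hf.fderiv_right (m := ∞) (by simp)).clm_apply contDiffAt_const

lemma _root_.ContDiffAt.differentiableAt_infty {f : ℝ × ℝ → V} {p : ℝ × ℝ}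
    (hf : ContDiffAt ℝ ∞ f p) : DifferentiableAt ℝ f p := hf.differentiableAt (by simp)

lemma du_congr {f g : ℝ × ℝ → V} {p : ℝ × ℝ} (h : f =ᶠ[nhds p] g) : du f p = du g p := by
  rw [du, du, h.fderiv_eq]

lemma dv_congr {f g : ℝ × ℝ → V} {p : ℝ × ℝ} (h : f =ᶠ[nhds p] g) : dv f p = dv g p := by
  rw [dv, dv, h.fderiv_eq]

lemma du_clm (φ : V →L[ℝ] W) {f : ℝ × ℝ → V} {p : ℝ × ℝ} (hf : DifferentiableAt ℝ f p) :
    du (fun q => φ (f q)) p = φ (du f p) := by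
  exact congrArg (fun L => L (1, 0)) (φ.hasFDerivAt.comp p hf.hasFDerivAt).fderiv

lemma dv_clm (φ : V →L[ℝ] W) {f : ℝ × ℝ → V} {p : ℝ × ℝ} (hf : DifferentiableAt ℝ f p) :
    dv (fun q => φ (f q)) p = φ (dv f p) := by
  exact congrArg (fun L => L (0, 1)) (φ.hasFDerivAt.comp p hf.hasFDerivAt).fderiv

lemma du_cross {f g : ℝ × ℝ → E3} {p : ℝ × ℝ} (hf : DifferentiableAt ℝ f p)
    (hg : DifferentiableAt ℝ g p) :
    du (fun q => cross (f q) (g q)) p = cross (f p) (du g p) + cross (du f p) (g p) := by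
  have := (crossL.hasFDerivAt_of_bilinear hf.hasFDerivAt hg.hasFDerivAt).fderiv
  simp only [crossL_apply] at this
  rw [du, this]; simp [du]

lemma dv_cross {f g : ℝ × ℝ → E3} {p : ℝ × ℝ} (hf : DifferentiableAt ℝ f p)
    (hg : DifferentiableAt ℝ g p) :
    dv (fun q => cross (f q) (g q)) p = cross (f p) (dv g p) + cross (dv f p) (g p) := by
  have := (crossL.hasFDerivAt_of_bilinear hf.hasFDerivAt hg.hasFDerivAt).fderiv
  simp only [crossL_apply] at this
  rw [dv, this]; simp [dv]

lemma du_inner {f g : ℝ × ℝ → E3} {p : ℝ × ℝ} (hf : DifferentiableAt ℝ f p)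
    (hg : DifferentiableAt ℝ g p) :
    du (fun q => (inner ℝ (f q) (g q) : ℝ)) p = inner ℝ (f p) (du g p) + inner ℝ (du f p) (g p) :=
  fderiv_inner_apply ℝ hf hg _

lemma dv_inner {f g : ℝ × ℝ → E3} {p : ℝ × ℝ} (hf : DifferentiableAt ℝ f p)
    (hg : DifferentiableAt ℝ g p) :
    dv (fun q => (inner ℝ (f q) (g q) : ℝ)) p = inner ℝ (f p) (dv g p) + inner ℝ (dv f p) (g p) :=
  fderiv_inner_apply ℝ hf hg _

lemma du_dv_comm {f : ℝ × ℝ → V} {p : ℝ × ℝ} (hf : ContDiffAt ℝ ∞ f p) :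
    du (dv f) p = dv (du f) p := by
  have hs : IsSymmSndFDerivAt ℝ f p :=
    hf.isSymmSndFDerivAt (by simp; exact WithTop.coe_le_coe.2 le_top)
  have hd : DifferentiableAt ℝ (fderiv ℝ f) p :=
    (hf.fderiv_right (m := ∞) (by simp)).differentiableAt (by simp)
  have h1 : du (dv f) p = fderiv ℝ (fderiv ℝ f) p (1, 0) (0, 1) := by
    change fderiv ℝ (fun q => fderiv ℝ f q (0, 1)) p (1, 0) = _
    rw [fderiv_clm_apply hd (differentiableAt_const _)]; simp
  have h2 : dv (du f) p = fderiv ℝ (fderiv ℝ f) p (0, 1) (1, 0) := by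
    change fderiv ℝ (fun q => fderiv ℝ f q (1, 0)) p (0, 1) = _
    rw [fderiv_clm_apply hd (differentiableAt_const _)]; simp
  rw [h1, h2, hs.eq]

end derivatives

/-! ### Smoothness and sign of the Gauss map. -/

namespace IsRegularPatch

variable {S : Set E3} {U : Set (ℝ × ℝ)} {x : ℝ × ℝ → E3}

lemma contDiffAt (h : IsRegularPatch S U x) {p : ℝ × ℝ} (hp : p ∈ U) : ContDiffAt ℝ ∞ x p :=
  h.smooth.contDiffAt (h.isOpen.mem_nhds hp)

lemma contDiffAt_cross (h : IsRegularPatch S U x) {p : ℝ × ℝ} (hp : p ∈ U) :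
    ContDiffAt ℝ ∞ (fun q => cross (du x q) (dv x q)) p :=
  (crossL.contDiff.contDiffAt.comp p (contDiffAt_du (h.contDiffAt hp))).clm_apply
    (contDiffAt_dv (h.contDiffAt hp))

lemma contDiffAt_norm_cross (h : IsRegularPatch S U x) {p : ℝ × ℝ} (hp : p ∈ U) :
    ContDiffAt ℝ ∞ (fun q => ‖cross (du x q) (dv x q)‖) p :=
  (h.contDiffAt_cross hp).norm ℝ (h.regular p hp)

lemma contDiffAt_gaussMap (h : IsRegularPatch S U x) {p : ℝ × ℝ} (hp : p ∈ U) :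
    ContDiffAt ℝ ∞ (gaussMap x) p :=
  ((h.contDiffAt_norm_cross hp).inv (norm_ne_zero_iff.2 (h.regular p hp))).smul
    (h.contDiffAt_cross hp)

lemma eventually_mem (h : IsRegularPatch S U x) {p : ℝ × ℝ} (hp : p ∈ U) :
    ∀ᶠ q in nhds p, q ∈ U := h.isOpen.mem_nhds hp

/-- A continuous unit normal field along a regular patch is, near every point, the Gauss map up
to a constant sign. -/
lemma exists_sign (h : IsRegularPatch S U x) {ν : ℝ × ℝ → E3} (hν : ContinuousOn ν U)
    (hu : ∀ q ∈ U, inner ℝ (ν q) (du x q) = (0 : ℝ))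
    (hv : ∀ q ∈ U, inner ℝ (ν q) (dv x q) = (0 : ℝ)) (h1 : ∀ q ∈ U, ‖ν q‖ = 1)
    {p : ℝ × ℝ} (hp : p ∈ U) :
    ∃ σ : ℝ, σ ^ 2 = 1 ∧ ∀ᶠ q in nhds p, gaussMap x q = σ • ν q := by
  have key := fun q hq => eq_smul_unit_normal (h.regular q hq) (hu q hq) (hv q hq) (h1 q hq)
  have hc : ContinuousAt (fun q => (inner ℝ (ν q) (gaussMap x q) : ℝ)) p :=
    (hν.continuousAt (h.isOpen.mem_nhds hp)).inner (h.contDiffAt_gaussMap hp).continuousAt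
  refine ⟨inner ℝ (ν p) (gaussMap x p), (key p hp).2, ?_⟩
  have hsq := (key p hp).2
  -- The inner product only takes the values `±1`, which are at distance 2, so staying within
  -- distance 1 freezes it.
  have hev := hc.eventually (Metric.ball_mem_nhds _ one_pos)
  filter_upwards [h.eventually_mem hp, hev] with q hq hb
  have h2 := (key q hq).2
  rw [show gaussMap x q = _ from (key q hq).1]
  congr 1
  change (inner ℝ (ν q) (gaussMap x q) : ℝ) ^ 2 = 1 at h2
  change (inner ℝ (ν p) (gaussMap x p) : ℝ) ^ 2 = 1 at hsq
  change (inner ℝ (ν q) (gaussMap x q) : ℝ) = _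
  rw [Real.dist_eq, abs_lt] at hb
  rcases sq_eq_one_iff.1 h2 with h2 | h2 <;>
    rcases sq_eq_one_iff.1 hsq with h3 | h3 <;> linarith

end IsRegularPatch

lemma laplaceBeltrami_congr (x : ℝ × ℝ → E3) {f g : ℝ × ℝ → ℝ} {p : ℝ × ℝ}
    (h : f =ᶠ[nhds p] g) : laplaceBeltrami x f p = laplaceBeltrami x g p := by
  have h' := h.eventuallyEq_nhds
  rw [laplaceBeltrami, laplaceBeltrami]
  congr 2
  · refine du_congr ?_
    filter_upwards [h'] with q hq
    rw [du_congr hq, dv_congr hq]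
  · refine dv_congr ?_
    filter_upwards [h'] with q hq
    rw [du_congr hq, dv_congr hq]

/-! ### The Laplacian on a patch and the sufficiency direction. -/

section

variable {S : Set E3} {U : Set (ℝ × ℝ)} {x : ℝ × ℝ → E3}

lemma eval_eq_proj (y : E3) (i : Fin 3) : y i = EuclideanSpace.proj (𝕜 := ℝ) i y := rfl

/-- The Laplacian of an affine function along a patch. -/
lemma IsRegularPatch.laplaceBeltrami_affine (h : IsRegularPatch S U x) (φ : E3 →L[ℝ] ℝ) (d : ℝ)
    {p : ℝ × ℝ} (hp : p ∈ U) :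
    laplaceBeltrami x (fun q => φ (x q) + d) p = -‖cross (du x p) (dv x p)‖⁻¹ *
      φ (cross (dv x p) (du (gaussMap x) p) + cross (dv (gaussMap x) p) (du x p)) := by
  have hx := h.contDiffAt hp
  have hn := (h.contDiffAt_gaussMap hp).differentiableAt_infty
  have hdu := (contDiffAt_du hx).differentiableAt_infty
  have hdv := (contDiffAt_dv hx).differentiableAt_infty
  have key : ∀ q ∈ U, du (fun q => φ (x q) + d) q = φ (du x q) ∧
      dv (fun q => φ (x q) + d) q = φ (dv x q) := fun q hq => by
    have hd := (h.contDiffAt hq).differentiableAt_infty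
    constructor
    · rw [← du_clm φ hd, du, du, fderiv_add_const]
    · rw [← dv_clm φ hd, dv, dv, fderiv_add_const]
  -- The fluxes `√g gⁱʲ ∂ⱼ x` are the rotated coordinate vectors `x_v × n` and `n × x_u`, by the
  -- triple product formula.
  have e1 : (fun q => √(gdet x q) * ((g22 x q / gdet x q) * du (fun q => φ (x q) + d) q +
      (-g12 x q / gdet x q) * dv (fun q => φ (x q) + d) q)) =ᶠ[nhds p]
      fun q => φ (cross (dv x q) (gaussMap x q)) := by
    filter_upwards [h.eventually_mem hp] with q hq
    have hm := norm_ne_zero_iff.2 (h.regular q hq)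
    rw [(key q hq).1, (key q hq).2, gaussMap, cross_smul_right, cross_cross, gdet_eq,
      Real.sqrt_sq (norm_nonneg _), g22, g12, real_inner_comm (dv x q) (du x q)]
    simp only [map_smul, map_sub, smul_eq_mul]
    field_simp
    ring
  have e2 : (fun q => √(gdet x q) * ((-g12 x q / gdet x q) * du (fun q => φ (x q) + d) q +
      (g11 x q / gdet x q) * dv (fun q => φ (x q) + d) q)) =ᶠ[nhds p]
      fun q => φ (cross (gaussMap x q) (du x q)) := by
    filter_upwards [h.eventually_mem hp] with q hq
    have hm := norm_ne_zero_iff.2 (h.regular q hq)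
    rw [(key q hq).1, (key q hq).2, gaussMap, cross_smul_left, cross_swap _ (du x q), cross_cross,
      gdet_eq, Real.sqrt_sq (norm_nonneg _), g11, g12]
    simp only [map_smul, map_sub, map_neg, smul_eq_mul]
    field_simp
    ring
  have d1 : DifferentiableAt ℝ (fun q => cross (dv x q) (gaussMap x q)) p :=
    (crossL.hasFDerivAt_of_bilinear hdv.hasFDerivAt hn.hasFDerivAt).differentiableAt
  have d2 : DifferentiableAt ℝ (fun q => cross (gaussMap x q) (du x q)) p :=
    (crossL.hasFDerivAt_of_bilinear hn.hasFDerivAt hdu.hasFDerivAt).differentiableAt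
  -- The two terms containing `x_uv` cancel, leaving only first derivatives of `n`.
  rw [laplaceBeltrami, du_congr e1, dv_congr e2, du_clm φ d1, dv_clm φ d2, du_cross hdv hn,
    dv_cross hn hdu, sqrt_gdet, du_dv_comm hx, cross_swap (gaussMap x p) (dv (du x) p), one_div,
    ← map_add]
  congr 2
  abel

/-- Differentiate `‖P (x - a)‖² = r²`; self-adjointness and idempotence of `P` remove the second
`P`. Hence `P (x - a)` is normal to the patch. -/
lemma IsRegularPatch.inner_du_eq_zero (h : IsRegularPatch S U x) {P : E3 →L[ℝ] E3}
    (hP : ∀ a b, (inner ℝ (P a) b : ℝ) = inner ℝ a (P b)) (hPP : ∀ a, P (P a) = P a)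
    {a : E3} {r : ℝ} (hS : ∀ y ∈ S, ‖P (y - a)‖ = r) {q : ℝ × ℝ} (hq : q ∈ U) :
    inner ℝ (P (x q - a)) (du x q) = (0 : ℝ) ∧ inner ℝ (P (x q - a)) (dv x q) = (0 : ℝ) := by
  have hd := (h.contDiffAt hq).differentiableAt_infty
  have hs : DifferentiableAt ℝ (fun q => x q - a) q := by fun_prop
  have hd' : DifferentiableAt ℝ (fun q => P (x q - a)) q := by fun_prop
  have hc : (fun q => (inner ℝ (P (x q - a)) (P (x q - a)) : ℝ)) =ᶠ[nhds q] fun _ => r ^ 2 := by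
    filter_upwards [h.eventually_mem hq] with s hs
    rw [real_inner_self_eq_norm_sq, hS _ (h.mapsTo hs)]
  constructor
  · have h1 := du_congr hc
    have h2 : du (fun q => x q - a) q = du x q := by rw [du, du, fderiv_sub_const]
    have h3 : du (fun _ : ℝ × ℝ => r ^ 2) q = 0 := by simp [du]
    rw [du_inner hd' hd', du_clm P hs, real_inner_comm (P (x q - a)), ← hP, hPP, h2, h3] at h1
    linarith
  · have h1 := dv_congr hc
    have h2 : dv (fun q => x q - a) q = dv x q := by rw [dv, dv, fderiv_sub_const]
    have h3 : dv (fun _ : ℝ × ℝ => r ^ 2) q = 0 := by simp [dv]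
    rw [dv_inner hd' hd', dv_clm P hs, real_inner_comm (P (x q - a)), ← hP, hPP, h2, h3] at h1
    linarith

/-- The Laplacian of the Gauss map of a set of constant distance to a point or a line. -/
lemma IsRegularPatch.laplaceBeltrami_gaussMap_of_norm_eq (h : IsRegularPatch S U x)
    {P : E3 →L[ℝ] E3} (hP : ∀ a b, (inner ℝ (P a) b : ℝ) = inner ℝ a (P b))
    (hPP : ∀ a, P (P a) = P a) {a : E3} {r : ℝ} (hr : 0 < r) (hS : ∀ y ∈ S, ‖P (y - a)‖ = r)
    {κ : ℝ} (hκ : ∀ a b, P (cross a b) = cross a b →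
      cross b (P a) + cross (P b) a = (-κ) • cross a b) {p : ℝ × ℝ} (hp : p ∈ U) (i : Fin 3) :
    laplaceBeltrami x (fun q => gaussMap x q i) p = κ / r ^ 2 * gaussMap x p i := by
  have hort := fun q hq => h.inner_du_eq_zero hP hPP hS (q := q) hq
  have hx : ContinuousOn x U := h.smooth.continuousOn
  obtain ⟨σ, hσ, hev⟩ := h.exists_sign (ν := fun q => r⁻¹ • P (x q - a)) (by fun_prop)
    (fun q hq => by simp only [inner_smul_left, (hort q hq).1, mul_zero])
    (fun q hq => by simp only [inner_smul_left, (hort q hq).2, mul_zero])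
    (fun q hq => by
      rw [norm_smul, hS _ (h.mapsTo hq), norm_inv, Real.norm_of_nonneg hr.le,
        inv_mul_cancel₀ hr.ne']) hp
  have hd := (h.contDiffAt hp).differentiableAt_infty
  have hs : DifferentiableAt ℝ (fun q => x q - a) p := by fun_prop
  have hev' : gaussMap x =ᶠ[nhds p] fun q => ((σ * r⁻¹) • P) (x q - a) := by
    filter_upwards [hev] with q hq
    rw [hq, smul_smul]; rfl
  have hnu : du (gaussMap x) p = (σ * r⁻¹) • P (du x p) := by
    rw [du_congr hev', du_clm _ hs, du, fderiv_sub_const]; rfl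
  have hnv : dv (gaussMap x) p = (σ * r⁻¹) • P (dv x p) := by
    rw [dv_congr hev', dv_clm _ hs, dv, fderiv_sub_const]; rfl
  have hPn : P (gaussMap x p) = gaussMap x p := by
    rw [hev'.self_of_nhds]; simp [hPP]
  have hm := norm_ne_zero_iff.2 (h.regular p hp)
  have hmn : cross (du x p) (dv x p) = ‖cross (du x p) (dv x p)‖ • gaussMap x p := by
    rw [gaussMap, smul_smul, mul_inv_cancel₀ hm, one_smul]
  have hPm : P (cross (du x p) (dv x p)) = cross (du x p) (dv x p) := by
    rw [hmn, map_smul, hPn]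
  -- Near `p` the component `n i` is `φ (x - a)`, so the formula for affine functions applies.
  set φ : E3 →L[ℝ] ℝ := (EuclideanSpace.proj i).comp ((σ * r⁻¹) • P) with hφ
  have hf : (fun q => gaussMap x q i) =ᶠ[nhds p] fun q => φ (x q) + -φ a := by
    filter_upwards [hev'] with q hq
    rw [hq, eval_eq_proj, ← sub_eq_add_neg, ← map_sub]; rfl
  rw [laplaceBeltrami_congr x hf, h.laplaceBeltrami_affine φ _ hp, hnu, hnv, cross_smul_left,
    cross_smul_right, ← smul_add, hκ _ _ hPm, hφ]
  simp only [ContinuousLinearMap.comp_apply, smul_apply, map_smul, hPm,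
    smul_eq_mul]
  rw [hmn]
  simp only [map_smul, ← eval_eq_proj, norm_smul, norm_norm, smul_eq_mul,
    norm_gaussMap (h.regular p hp)]
  field_simp
  linear_combination (κ * gaussMap x p i) * hσ

lemma gaussMapSatisfies_of_isSphere (h : IsSphere S) : ∃ Λ, GaussMapSatisfies S Λ := by
  obtain ⟨c, r, hr, rfl⟩ := h
  refine ⟨(2 / r ^ 2) • 1, fun U x hx p hp i => ?_⟩
  rw [hx.laplaceBeltrami_gaussMap_of_norm_eq (P := ContinuousLinearMap.id ℝ E3) (a := c)
    (r := r) (κ := 2) (by simp) (by simp) hr (fun y hy => by simpa [dist_eq_norm] using hy)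
    (fun a b _ => ?_) hp]
  · simp [Matrix.one_apply]
  · simp only [ContinuousLinearMap.id_apply]
    rw [cross_swap b a, neg_smul, two_smul, neg_add]

lemma gaussMapSatisfies_of_isCircularCylinder (h : IsCircularCylinder S) :
    ∃ Λ, GaussMapSatisfies S Λ := by
  obtain ⟨a, v, r, hv, hr, rfl⟩ := h
  refine ⟨(1 / r ^ 2) • 1, fun U x hx p hp i => ?_⟩
  have hvv : (inner ℝ v v : ℝ) = 1 := by rw [real_inner_self_eq_norm_sq, hv, one_pow]
  set P : E3 →L[ℝ] E3 := ContinuousLinearMap.id ℝ E3 - (innerSL ℝ v).smulRight v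
  have hP : ∀ y, P y = y - (inner ℝ v y : ℝ) • v := fun y => by simp [P]
  rw [hx.laplaceBeltrami_gaussMap_of_norm_eq (P := P) (a := a)
    (r := r) (κ := 1) (fun y z => ?_) (fun y => ?_) hr (fun y hy => by rw [hP]; exact hy)
    (fun b c hbc => ?_) hp]
  · simp [Matrix.one_apply]
  · rw [hP, hP, inner_sub_left, inner_sub_right, inner_smul_left, inner_smul_right,
      real_inner_comm v y]
    simp; ring
  · rw [hP (P y), hP, inner_sub_right, inner_smul_right, hvv]; simp
  -- `P` fixes `b × c`, so the axis `v` is orthogonal to it and `v × (v × (b × c)) = -(b × c)`;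
  -- expanding the inner product `v × (b × c)` gives the required relation with `κ = 1`.
  · have h0 : (inner ℝ v (cross b c) : ℝ) = 0 := by
      have : (inner ℝ v (cross b c) : ℝ) • v = 0 := by simpa [hP] using hbc
      have := congrArg (fun z => (inner ℝ v z : ℝ)) this
      simpa only [inner_smul_right, hvv, mul_one, inner_zero_right] using this
    have h1 := cross_cross v b c
    have h2 := cross_cross v v (cross b c)
    rw [h0, h1, hvv, cross_sub_right, cross_smul_right, cross_smul_right] at h2
    rw [hP, hP, cross_sub_left, cross_sub_right, cross_smul_left, cross_smul_right,
      cross_swap c b, cross_swap c v]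
    linear_combination (norm := module) (-1 : ℝ) • h2

lemma gaussMapSatisfies_of_isPlane (h : IsPlane S) : ∃ Λ, GaussMapSatisfies S Λ := by
  obtain ⟨v, d, hv, rfl⟩ := h
  refine ⟨0, fun U x hx p hp i => ?_⟩
  have hc : ∀ q ∈ U, (fun s => innerSL ℝ v (x s)) =ᶠ[nhds q] fun _ => d := fun q hq => by
    filter_upwards [hx.eventually_mem hq] with s hs using hx.mapsTo hs
  obtain ⟨σ, hσ, hev⟩ := hx.exists_sign (ν := fun q => ‖v‖⁻¹ • v) (by fun_prop)
    (fun q hq => by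
      have := du_congr (hc q hq)
      rw [du_clm _ (hx.contDiffAt hq).differentiableAt_infty] at this
      simp only [innerSL_apply_apply] at this
      rw [inner_smul_left, this]; simp [du])
    (fun q hq => by
      have := dv_congr (hc q hq)
      rw [dv_clm _ (hx.contDiffAt hq).differentiableAt_infty] at this
      simp only [innerSL_apply_apply] at this
      rw [inner_smul_left, this]; simp [dv])
    (fun q hq => norm_smul_inv_norm hv) hp
  have : (fun q => gaussMap x q i) =ᶠ[nhds p] fun _ => (σ • ‖v‖⁻¹ • v) i := by
    filter_upwards [hev] with q hq; rw [hq]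
  rw [laplaceBeltrami_congr x this]
  simp [laplaceBeltrami, du, dv]

lemma sum_mul_eq_inner (y z : E3) : ∑ i, y i * z i = inner ℝ y z := by
  rw [inner_eq_coord, Fin.sum_univ_three]

lemma IsRegularPatch.inner_gaussMap_fderiv (h : IsRegularPatch S U x) {q : ℝ × ℝ} (hq : q ∈ U)
    (z : ℝ × ℝ) : inner ℝ (gaussMap x q) (fderiv ℝ (gaussMap x) q z) = (0 : ℝ) := by
  have hd := (h.contDiffAt_gaussMap hq).differentiableAt_infty
  have hc : (fun s => (inner ℝ (gaussMap x s) (gaussMap x s) : ℝ)) =ᶠ[nhds q] fun _ => 1 := by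
    filter_upwards [h.eventually_mem hq] with s hs
    rw [real_inner_self_eq_norm_sq, norm_gaussMap (h.regular s hs), one_pow]
  have h1 := fderiv_inner_apply ℝ hd hd z
  rw [hc.fderiv_eq, real_inner_comm (gaussMap x q), fderiv_fun_const] at h1
  simp only [Pi.zero_apply, zero_apply] at h1
  linarith

/-- The normal component of the Laplacian of the Gauss map, at a point where the coordinate
vectors are orthonormal. -/
lemma IsRegularPatch.sum_gaussMap_mul_laplaceBeltrami (h : IsRegularPatch S U x) {p : ℝ × ℝ}
    (hp : p ∈ U) (h11 : g11 x p = 1) (h12 : g12 x p = 0) (h22 : g22 x p = 1) :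
    ∑ i, gaussMap x p i * laplaceBeltrami x (fun q => gaussMap x q i) p =
      ‖du (gaussMap x) p‖ ^ 2 + ‖dv (gaussMap x) p‖ ^ 2 := by
  have hx := h.contDiffAt hp
  have hn := h.contDiffAt_gaussMap hp
  have hxu := contDiffAt_du hx
  have hxv := contDiffAt_dv hx
  have hnd := hn.differentiableAt_infty
  have hg : gdet x p = 1 := by rw [gdet, h11, h12, h22]; norm_num
  have d11 : DifferentiableAt ℝ (g11 x) p := (hxu.inner ℝ hxu).differentiableAt_infty
  have d12 : DifferentiableAt ℝ (g12 x) p := (hxu.inner ℝ hxv).differentiableAt_infty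
  have d22 : DifferentiableAt ℝ (g22 x) p := (hxv.inner ℝ hxv).differentiableAt_infty
  have dg : DifferentiableAt ℝ (gdet x) p := (d11.mul d22).sub (d12.pow 2)
  have hg0 : gdet x p ≠ 0 := by simp [hg]
  have ds : DifferentiableAt ℝ (fun q => √(gdet x q)) p := dg.sqrt hg0
  have dnu := (contDiffAt_du hn).differentiableAt_infty
  have dnv := (contDiffAt_dv hn).differentiableAt_infty
  -- The vector-valued fluxes. They are orthogonal to `n`, so differentiating `⟨n, Vᵢ⟩ = 0` trades
  -- `⟨n, ∂ᵢ Vᵢ⟩` for `-⟨∂ᵢ n, Vᵢ⟩`, and no derivative of the metric is ever computed.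
  set V₁ : ℝ × ℝ → E3 := fun q => √(gdet x q) • ((g22 x q / gdet x q) • du (gaussMap x) q +
    (-g12 x q / gdet x q) • dv (gaussMap x) q) with hV₁
  set V₂ : ℝ × ℝ → E3 := fun q => √(gdet x q) • ((-g12 x q / gdet x q) • du (gaussMap x) q +
    (g11 x q / gdet x q) • dv (gaussMap x) q) with hV₂
  have dV₁ : DifferentiableAt ℝ V₁ p := by fun_prop (disch := assumption)
  have dV₂ : DifferentiableAt ℝ V₂ p := by fun_prop (disch := assumption)
  have hperp : ∀ q ∈ U, (inner ℝ (gaussMap x q) (du (gaussMap x) q) : ℝ) = 0 ∧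
      (inner ℝ (gaussMap x q) (dv (gaussMap x) q) : ℝ) = 0 := fun q hq =>
    ⟨h.inner_gaussMap_fderiv hq _, h.inner_gaussMap_fderiv hq _⟩
  have z₁ : (fun q => (inner ℝ (gaussMap x q) (V₁ q) : ℝ)) =ᶠ[nhds p] fun _ => 0 := by
    filter_upwards [h.eventually_mem hp] with q hq
    simp only [hV₁, inner_smul_right, inner_add_right, (hperp q hq).1, (hperp q hq).2]; simp
  have z₂ : (fun q => (inner ℝ (gaussMap x q) (V₂ q) : ℝ)) =ᶠ[nhds p] fun _ => 0 := by
    filter_upwards [h.eventually_mem hp] with q hq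
    simp only [hV₂, inner_smul_right, inner_add_right, (hperp q hq).1, (hperp q hq).2]; simp
  have hLB : ∀ i, laplaceBeltrami x (fun q => gaussMap x q i) p =
      -(du V₁ p + dv V₂ p) i := fun i => by
    have c1 : ∀ q ∈ U, du (fun q => gaussMap x q i) q = du (gaussMap x) q i ∧
        dv (fun q => gaussMap x q i) q = dv (gaussMap x) q i := fun q hq =>
      ⟨du_clm (EuclideanSpace.proj i) (h.contDiffAt_gaussMap hq).differentiableAt_infty,
        dv_clm (EuclideanSpace.proj i) (h.contDiffAt_gaussMap hq).differentiableAt_infty⟩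
    have e₁ := du_clm (EuclideanSpace.proj (𝕜 := ℝ) i) dV₁
    have e₂ := dv_clm (EuclideanSpace.proj (𝕜 := ℝ) i) dV₂
    rw [laplaceBeltrami, hg, Real.sqrt_one, PiLp.add_apply, eval_eq_proj, eval_eq_proj, ← e₁,
      ← e₂]
    have t₁ : (fun q => √(gdet x q) * ((g22 x q / gdet x q) * du (fun q => gaussMap x q i) q +
        (-g12 x q / gdet x q) * dv (fun q => gaussMap x q i) q)) =ᶠ[nhds p]
        (fun q => EuclideanSpace.proj (𝕜 := ℝ) i (V₁ q)) := by
      filter_upwards [h.eventually_mem hp] with q hq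
      rw [(c1 q hq).1, (c1 q hq).2]; simp [hV₁]; ring
    have t₂ : (fun q => √(gdet x q) * ((-g12 x q / gdet x q) * du (fun q => gaussMap x q i) q +
        (g11 x q / gdet x q) * dv (fun q => gaussMap x q i) q)) =ᶠ[nhds p]
        (fun q => EuclideanSpace.proj (𝕜 := ℝ) i (V₂ q)) := by
      filter_upwards [h.eventually_mem hp] with q hq
      rw [(c1 q hq).1, (c1 q hq).2]; simp [hV₂]; ring
    rw [du_congr t₁, dv_congr t₂]; ring
  have i₁ := du_congr z₁
  have i₂ := dv_congr z₂
  rw [du_inner hnd dV₁] at i₁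
  rw [dv_inner hnd dV₂] at i₂
  have v₁ : V₁ p = du (gaussMap x) p := by simp [hV₁, hg, h22, h12]
  have v₂ : V₂ p = dv (gaussMap x) p := by simp [hV₂, hg, h11, h12]
  rw [v₁, real_inner_self_eq_norm_sq] at i₁
  rw [v₂, real_inner_self_eq_norm_sq] at i₂
  simp only [hLB]
  have := sum_mul_eq_inner (gaussMap x p) (-(du V₁ p + dv V₂ p))
  simp only [PiLp.neg_apply] at this
  rw [this, inner_neg_right, inner_add_right]
  have k₁ : du (fun _ : ℝ × ℝ => (0 : ℝ)) p = 0 := by simp [du]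
  have k₂ : dv (fun _ : ℝ × ℝ => (0 : ℝ)) p = 0 := by simp [dv]
  linarith

end

/-! ### Patches of a quadric and the polynomial identity. -/

/-- The quadratic polynomial with Hessian `D`, linear part `b` and constant term `c`. -/
noncomputable def quadPoly (D : E3 →L[ℝ] E3) (b : E3) (c : ℝ) (y : E3) : ℝ :=
  inner ℝ (D y) y / 2 + inner ℝ b y + c

section

variable {D : E3 →L[ℝ] E3} {b : E3} {c : ℝ}

lemma quadPoly_add (hD : ∀ y z, (inner ℝ (D y) z : ℝ) = inner ℝ y (D z)) (y z : E3) :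
    quadPoly D b c (y + z) = quadPoly D b c y + inner ℝ (D y + b) z + inner ℝ (D z) z / 2 := by
  have h : (inner ℝ (D z) y : ℝ) = inner ℝ (D y) z := by rw [hD, real_inner_comm]
  simp only [quadPoly, map_add, inner_add_left, inner_add_right, h]
  ring

lemma exists_orthonormalBasis_last {ν : E3} (hν : ‖ν‖ = 1) :
    ∃ f : OrthonormalBasis (Fin 3) ℝ E3, f 2 = ν := by
  have hv : Orthonormal ℝ (({2} : Set (Fin 3)).domRestrict fun _ => ν) := by
    refine ⟨fun _ => hν, fun i j hij => (hij (Subsingleton.elim i j)).elim⟩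
  obtain ⟨f, hf⟩ := hv.exists_orthonormalBasis_extension_of_card_eq (by simp)
  exact ⟨f, hf 2 rfl⟩

lemma norm_sq_eq_sum (f : OrthonormalBasis (Fin 3) ℝ E3) (y : E3) :
    ‖y‖ ^ 2 = inner ℝ (f 0) y ^ 2 + inner ℝ (f 1) y ^ 2 + inner ℝ (f 2) y ^ 2 := by
  rw [← f.sum_sq_inner_right, Fin.sum_univ_three]

/-- The Hilbert–Schmidt norm does not depend on the basis. This passes from a frame adapted to the
point to the fixed eigenbasis. -/
lemma sum_norm_sq_eq (hD : ∀ y z, (inner ℝ (D y) z : ℝ) = inner ℝ y (D z))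
    (e f : OrthonormalBasis (Fin 3) ℝ E3) : ∑ i, ‖D (e i)‖ ^ 2 = ∑ i, ‖D (f i)‖ ^ 2 := by
  have h1 : ∀ i, ‖D (e i)‖ ^ 2 = ∑ j, (inner ℝ (D (f j)) (e i) : ℝ) ^ 2 := fun i => by
    rw [← f.sum_sq_inner_right]
    exact Finset.sum_congr rfl fun j _ => by rw [hD]
  simp only [h1]
  rw [Finset.sum_comm]
  exact Finset.sum_congr rfl fun j _ => e.sum_sq_inner_left _

lemma hasFDerivAt_quadPoly (hD : ∀ y z, (inner ℝ (D y) z : ℝ) = inner ℝ y (D z)) (y : E3) :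
    HasFDerivAt (quadPoly D b c) (innerSL ℝ (D y + b)) y := by
  have h1 : HasFDerivAt (fun y => (inner ℝ (D y) y : ℝ)) _ y :=
    D.hasFDerivAt.inner ℝ (hasFDerivAt_id y)
  have h2 : HasFDerivAt (fun y => (inner ℝ b y : ℝ)) (innerSL ℝ b) y :=
    (innerSL ℝ b).hasFDerivAt
  have h3 : HasFDerivAt (quadPoly D b c) _ y := ((h1.mul_const 2⁻¹).fun_add h2).add_const c
  refine h3.congr_fderiv (ContinuousLinearMap.ext fun z => ?_)
  have hs : (inner ℝ (D z) y : ℝ) = inner ℝ (D y) z := by rw [hD, real_inner_comm]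
  simp [fderivInnerCLM_apply, hs]
  ring

lemma inner_grad_fderiv (hD : ∀ y z, (inner ℝ (D y) z : ℝ) = inner ℝ y (D z))
    {x : ℝ × ℝ → E3} {q : ℝ × ℝ} (hx : DifferentiableAt ℝ x q)
    (h : ∀ᶠ s in nhds q, quadPoly D b c (x s) = 0) (z : ℝ × ℝ) :
    inner ℝ (D (x q) + b) (fderiv ℝ x q z) = (0 : ℝ) := by
  have h1 := ((hasFDerivAt_quadPoly (b := b) (c := c) hD (x q)).comp q hx.hasFDerivAt).fderiv
  have h2 : (quadPoly D b c ∘ x) =ᶠ[nhds q] fun _ => 0 := h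
  rw [h2.fderiv_eq, fderiv_fun_const] at h1
  exact (congrArg (fun L => L z) h1).symm

/-- Through a point of a quadric where the gradient does not vanish there passes a regular patch
whose coordinate vectors at the point are prescribed orthonormal tangent vectors. -/
lemma exists_patch_quadPoly (hD : ∀ y z, (inner ℝ (D y) z : ℝ) = inner ℝ y (D z))
    {p : E3} (hp : quadPoly D b c p = 0) (f : OrthonormalBasis (Fin 3) ℝ E3) {W : ℝ} (hW : 0 < W)
    (hN : D p + b = W • f 2) :
    ∃ (U : Set (ℝ × ℝ)) (x : ℝ × ℝ → E3), IsRegularPatch {y | quadPoly D b c y = 0} U x ∧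
      0 ∈ U ∧ x 0 = p ∧ du x 0 = f 0 ∧ dv x 0 = f 1 := by
  have e00 : (inner ℝ (f 0) (f 0) : ℝ) = 1 := by simp
  have e01 : (inner ℝ (f 0) (f 1) : ℝ) = 0 := f.orthonormal.2 (by decide)
  have e02 : (inner ℝ (f 0) (f 2) : ℝ) = 0 := f.orthonormal.2 (by decide)
  have e11 : (inner ℝ (f 1) (f 1) : ℝ) = 1 := by simp
  have e12 : (inner ℝ (f 1) (f 2) : ℝ) = 0 := f.orthonormal.2 (by decide)
  have e20 : (inner ℝ (f 2) (f 0) : ℝ) = 0 := f.orthonormal.2 (by decide)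
  have e21 : (inner ℝ (f 2) (f 1) : ℝ) = 0 := f.orthonormal.2 (by decide)
  have e22 : (inner ℝ (f 2) (f 2) : ℝ) = 1 := by simp
  set d : ℝ := inner ℝ (D (f 2)) (f 2) with hd
  set ξ : ℝ × ℝ → E3 := fun q => q.1 • f 0 + q.2 • f 1 with hξ
  set Q : ℝ × ℝ → ℝ := fun q => inner ℝ (D (ξ q)) (ξ q) with hQ
  set B : ℝ × ℝ → ℝ := fun q => W + inner ℝ (D (ξ q)) (f 2) with hB
  set R : ℝ × ℝ → ℝ := fun q => B q ^ 2 - d * Q q with hR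
  -- The quadric is written as a graph over its tangent plane: the height solves `d h² + 2 B h + Q =
  -- 0`. The root vanishing at the origin is taken in rationalised form, which stays valid when `d =
  -- 0`.
  set h : ℝ × ℝ → ℝ := fun q => -Q q / (B q + √(R q)) with hh
  set x : ℝ × ℝ → E3 := fun q => p + (ξ q + h q • f 2) with hx
  have cξ : ContDiff ℝ ∞ ξ := by fun_prop
  have cQ : ContDiff ℝ ∞ Q := (D.contDiff.comp cξ).inner ℝ cξ
  have cB : ContDiff ℝ ∞ B := contDiff_const.add ((D.contDiff.comp cξ).inner ℝ contDiff_const)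
  have cR : ContDiff ℝ ∞ R := (cB.pow 2).sub (contDiff_const.mul cQ)
  set U : Set (ℝ × ℝ) := {q | 0 < B q} ∩ {q | 0 < R q} with hU
  have oU : IsOpen U :=
    (isOpen_lt continuous_const cB.continuous).inter (isOpen_lt continuous_const cR.continuous)
  have ch : ∀ q ∈ U, ContDiffAt ℝ ∞ h q := fun q hq =>
    cQ.contDiffAt.neg.div (cB.contDiffAt.add (cR.contDiffAt.sqrt hq.2.ne'))
      (add_pos_of_pos_of_nonneg hq.1 (Real.sqrt_nonneg _)).ne'
  have cx : ∀ q ∈ U, ContDiffAt ℝ ∞ x q := fun q hq =>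
    contDiffAt_const.add (cξ.contDiffAt.add ((ch q hq).smul contDiffAt_const))
  have hxd : ∀ q ∈ U, ∀ z : ℝ × ℝ,
      fderiv ℝ x q z = z.1 • f 0 + z.2 • f 1 + fderiv ℝ h q z • f 2 := fun q hq z => by
    have h1 : HasFDerivAt ξ ((ContinuousLinearMap.fst ℝ ℝ ℝ).smulRight (f 0) +
        (ContinuousLinearMap.snd ℝ ℝ ℝ).smulRight (f 1)) q :=
      (hasFDerivAt_fst.smul_const (f 0)).add (hasFDerivAt_snd.smul_const (f 1))
    have h2 := (ch q hq).differentiableAt_infty.hasFDerivAt.smul_const (f 2)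
    have h3 : HasFDerivAt x _ q := (h1.fun_add h2).const_add p
    rw [h3.fderiv]
    simp
  have hxu : ∀ q ∈ U, du x q = f 0 + du h q • f 2 := fun q hq => by
    rw [du, hxd q hq]; simp [du]
  have hxv : ∀ q ∈ U, dv x q = f 1 + dv h q • f 2 := fun q hq => by
    rw [dv, hxd q hq]; simp [dv]
  have hmaps : ∀ q ∈ U, quadPoly D b c (x q) = 0 := fun q hq => by
    have hpos : 0 < B q + √(R q) := add_pos_of_pos_of_nonneg hq.1 (Real.sqrt_nonneg _)
    have hsq : √(R q) ^ 2 = B q ^ 2 - d * Q q := Real.sq_sqrt (le_of_lt hq.2)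
    have hsym : (inner ℝ (D (f 2)) (ξ q) : ℝ) = inner ℝ (D (ξ q)) (f 2) := by
      rw [hD, real_inner_comm]
    have h1 : quadPoly D b c (x q) = B q * h q + Q q / 2 + d * h q ^ 2 / 2 := by
      rw [hx, quadPoly_add hD, hp, hN]
      have : (inner ℝ (f 2) (ξ q) : ℝ) = 0 := by
        simp [hξ, inner_add_right, inner_smul_right, e20, e21]
      simp only [map_add, map_smul, inner_add_left, inner_add_right, inner_smul_left,
        inner_smul_right, this, e22, hsym, ← hd, conj_trivial, hB, hQ]
      ring
    rw [h1, hh]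
    simp only
    field_simp
    linear_combination Q q * hsq
  have h0 : (0 : ℝ × ℝ) ∈ U := by
    have : ξ 0 = 0 := by simp [hξ]
    simp [hU, hR, hB, hQ, this, hW]
  have hξ0 : ξ 0 = 0 := by simp [hξ]
  have hx0 : x 0 = p := by simp [hx, hh, hQ, hξ0]
  have hpatch : IsRegularPatch {y | quadPoly D b c y = 0} U x := by
    refine ⟨oU, fun q hq => (cx q hq).contDiffWithinAt, fun q hq hc => ?_, hmaps⟩
    have := norm_cross_sq (du x q) (dv x q)
    rw [hc, hxu q hq, hxv q hq] at this
    simp only [inner_add_left, inner_add_right, inner_smul_left, inner_smul_right, e00, e01, e02,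
      e11, e12, e22, e20, e21, conj_trivial, norm_zero] at this
    nlinarith [sq_nonneg (du h q), sq_nonneg (dv h q)]
  -- The gradient at `p` is a multiple of `f 2` and is orthogonal to the patch, so the height has
  -- zero differential there.
  have hz : ∀ z, fderiv ℝ h 0 z = 0 := fun z => by
    have := inner_grad_fderiv hD (c := c) (cx 0 h0).differentiableAt_infty
      (Filter.mem_of_superset (oU.mem_nhds h0) hmaps) z
    rw [hxd 0 h0, hx0, hN] at this
    simp only [inner_add_right, inner_smul_left, inner_smul_right, e20, e21, e22,
      conj_trivial] at this
    simpa [hW.ne'] using this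
  refine ⟨U, x, hpatch, h0, hx0, ?_, ?_⟩
  · rw [hxu 0 h0, du, hz]; simp
  · rw [hxv 0 h0, dv, hz]; simp

/-- A quadratic form is even, so the unknown sign of the normal drops out. -/
lemma sum_mul_sum_smul_sq {σ : ℝ} (hσ : σ ^ 2 = 1) (Λ : Matrix (Fin 3) (Fin 3) ℝ) (y : E3) :
    ∑ i, (σ • y) i * ∑ j, Λ i j * (σ • y) j = inner ℝ y (Matrix.toEuclideanCLM (𝕜 := ℝ) Λ y) := by
  rw [← sum_mul_eq_inner]
  refine Finset.sum_congr rfl fun i _ => ?_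
  have : Matrix.toEuclideanCLM (𝕜 := ℝ) Λ y i = ∑ j, Λ i j * y j := rfl
  rw [this, Finset.mul_sum, Finset.mul_sum]
  refine Finset.sum_congr rfl fun j _ => ?_
  simp only [PiLp.smul_apply, smul_eq_mul]
  linear_combination (y i * (Λ i j * y j)) * hσ

/-- The normal component of `Δ n = Λ n` on a quadric: `|B|² = ⟨n, Λ n⟩` in terms of the gradient
`N = D p + b` of the defining polynomial. -/
lemma GaussMapSatisfies.quadPoly_identity
    (hD : ∀ y z, (inner ℝ (D y) z : ℝ) = inner ℝ y (D z)) {Λ : Matrix (Fin 3) (Fin 3) ℝ}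
    (hΛ : GaussMapSatisfies {y | quadPoly D b c y = 0} Λ) (e : OrthonormalBasis (Fin 3) ℝ E3)
    {p N : E3} (hp : quadPoly D b c p = 0) (hpN : D p + b = N) (hN : N ≠ 0) :
    (‖N‖ ^ 2) ^ 2 * ∑ i, ‖D (e i)‖ ^ 2 - 2 * ‖N‖ ^ 2 * ‖D N‖ ^ 2 + inner ℝ (D N) N ^ 2 =
      (‖N‖ ^ 2) ^ 2 * inner ℝ N (Matrix.toEuclideanCLM (𝕜 := ℝ) Λ N) := by
  obtain ⟨f, hf⟩ := exists_orthonormalBasis_last (norm_smul_inv_norm (𝕜 := ℝ) hN)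
  have hW : 0 < ‖N‖ := norm_pos_iff.2 hN
  have hNf : N = ‖N‖ • f 2 := by
    rw [hf]; simp [smul_smul, mul_inv_cancel₀ hW.ne']
  obtain ⟨U, x, hx, h0, hx0, hxu, hxv⟩ := exists_patch_quadPoly hD hp f hW (hpN.trans hNf)
  have e00 : (inner ℝ (f 0) (f 0) : ℝ) = 1 := by simp
  have e11 : (inner ℝ (f 1) (f 1) : ℝ) = 1 := by simp
  have e01 : (inner ℝ (f 0) (f 1) : ℝ) = 0 := f.orthonormal.2 (by decide)
  have e20 : (inner ℝ (f 2) (f 0) : ℝ) = 0 := f.orthonormal.2 (by decide)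
  have e21 : (inner ℝ (f 2) (f 1) : ℝ) = 0 := f.orthonormal.2 (by decide)
  have hsum := hx.sum_gaussMap_mul_laplaceBeltrami h0 (by rw [g11, hxu, e00])
    (by rw [g12, hxu, hxv, e01]) (by rw [g22, hxv, e11])
  simp only [hΛ U x hx 0 h0] at hsum
  obtain ⟨hn, hσ⟩ := eq_smul_unit_normal (ν := f 2) (hx.regular 0 h0) (by rw [hxu, e20])
    (by rw [hxv, e21]) (f.orthonormal.1 2)
  change gaussMap x 0 = _ at hn
  set σ : ℝ := inner ℝ (f 2) (‖cross (du x 0) (dv x 0)‖⁻¹ • cross (du x 0) (dv x 0))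
  rw [hn, sum_mul_sum_smul_sq hσ] at hsum
  have hcx := hx.contDiffAt h0
  have hdx := hcx.differentiableAt_infty
  have hdn := (hx.contDiffAt_gaussMap h0).differentiableAt_infty
  have hdDx : DifferentiableAt ℝ (fun q => D (x q) + b) 0 := by fun_prop
  -- second fundamental form from the two equations `⟨n, x_w⟩ = 0` and `⟨N, x_w⟩ = 0`
  have hgrad : ∀ q ∈ U, ∀ z, (inner ℝ (D (x q) + b) (fderiv ℝ x q z) : ℝ) = 0 := fun q hq z =>
    inner_grad_fderiv hD (hx.contDiffAt hq).differentiableAt_infty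
      (Filter.mem_of_superset (hx.isOpen.mem_nhds hq) hx.mapsTo) z
  have hnu : ∀ q, (inner ℝ (gaussMap x q) (du x q) : ℝ) = 0 := fun q => by
    rw [gaussMap, inner_smul_left, real_inner_comm, inner_cross_self_left, mul_zero]
  have hnv : ∀ q, (inner ℝ (gaussMap x q) (dv x q) : ℝ) = 0 := fun q => by
    rw [gaussMap, inner_smul_left, real_inner_comm, inner_cross_self_right, mul_zero]
  have second : ∀ (y : ℝ × ℝ → E3) (z : ℝ × ℝ), DifferentiableAt ℝ y 0 →
      (∀ q, (inner ℝ (gaussMap x q) (y q) : ℝ) = 0) →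
      (∀ q ∈ U, (inner ℝ (D (x q) + b) (y q) : ℝ) = 0) →
      ‖N‖ * inner ℝ (fderiv ℝ (gaussMap x) 0 z) (y 0) =
        σ * inner ℝ (D (fderiv ℝ x 0 z)) (y 0) := fun y z hy h1 h2 => by
    have a1 := fderiv_inner_apply ℝ hdn hy z
    have a2 := fderiv_inner_apply ℝ hdDx hy z
    have b2 : (fun q => (inner ℝ (D (x q) + b) (y q) : ℝ)) =ᶠ[nhds 0] fun _ => 0 :=
      Filter.mem_of_superset (hx.isOpen.mem_nhds h0) h2
    have b3 : fderiv ℝ (fun q => D (x q) + b) 0 z = D (fderiv ℝ x 0 z) := by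
      rw [fderiv_add_const]
      exact congrArg (fun L => L z) (D.hasFDerivAt.comp 0 hdx.hasFDerivAt).fderiv
    simp only [h1] at a1
    rw [b2.fderiv_eq, b3, hx0, hpN, hNf] at a2
    rw [hn] at a1
    simp only [fderiv_fun_const, Pi.zero_apply, zero_apply, inner_smul_left,
      conj_trivial] at a1 a2
    linear_combination σ * a2 - ‖N‖ * a1
  have cu := (contDiffAt_du hcx).differentiableAt_infty
  have cv := (contDiffAt_dv hcx).differentiableAt_infty
  have s00 := second _ (1, 0) cu hnu fun q hq => hgrad q hq _
  have s01 := second _ (1, 0) cv hnv fun q hq => hgrad q hq _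
  have s10 := second _ (0, 1) cu hnu fun q hq => hgrad q hq _
  have s11 := second _ (0, 1) cv hnv fun q hq => hgrad q hq _
  have t0 : (inner ℝ (f 2) (du (gaussMap x) 0) : ℝ) = 0 := by
    have := hx.inner_gaussMap_fderiv h0 (1, 0)
    rw [hn, inner_smul_left] at this
    refine (mul_eq_zero.1 this).resolve_left fun h => ?_
    rw [conj_trivial] at h
    simp [h] at hσ
  have t1 : (inner ℝ (f 2) (dv (gaussMap x) 0) : ℝ) = 0 := by
    have := hx.inner_gaussMap_fderiv h0 (0, 1)
    rw [hn, inner_smul_left] at this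
    refine (mul_eq_zero.1 this).resolve_left fun h => ?_
    rw [conj_trivial] at h
    simp [h] at hσ
  change ‖N‖ * inner ℝ (du (gaussMap x) 0) (du x 0) = σ * inner ℝ (D (du x 0)) (du x 0) at s00
  change ‖N‖ * inner ℝ (du (gaussMap x) 0) (dv x 0) = σ * inner ℝ (D (du x 0)) (dv x 0) at s01
  change ‖N‖ * inner ℝ (dv (gaussMap x) 0) (du x 0) = σ * inner ℝ (D (dv x 0)) (du x 0) at s10
  change ‖N‖ * inner ℝ (dv (gaussMap x) 0) (dv x 0) = σ * inner ℝ (D (dv x 0)) (dv x 0) at s11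
  simp only [hxu, hxv] at s00 s01 s10 s11
  rw [norm_sq_eq_sum f (du (gaussMap x) 0), norm_sq_eq_sum f (dv (gaussMap x) 0), t0, t1,
    real_inner_comm _ (f 0), real_inner_comm _ (f 1), real_inner_comm _ (f 0),
    real_inner_comm _ (f 1)] at hsum
  have hsym : ∀ i j, (inner ℝ (f j) (D (f i)) : ℝ) = inner ℝ (D (f j)) (f i) := fun i j => by
    rw [hD]
  have hcomm : ∀ i j, (inner ℝ (D (f i)) (f j) : ℝ) = inner ℝ (D (f j)) (f i) := fun i j => by
    rw [hD, real_inner_comm]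
  -- The left side is the sum of squares of the tangential 2×2 block of `D`: row and column of `f 2`
  -- are removed from the full sum, and the corner, removed twice, is added back.
  have main : ∑ i, ‖D (f i)‖ ^ 2 - 2 * ‖D (f 2)‖ ^ 2 + inner ℝ (D (f 2)) (f 2) ^ 2 =
      ‖N‖ ^ 2 * inner ℝ (f 2) (Matrix.toEuclideanCLM (𝕜 := ℝ) Λ (f 2)) := by
    rw [hsum, Fin.sum_univ_three, norm_sq_eq_sum f (D (f 0)), norm_sq_eq_sum f (D (f 1)),
      norm_sq_eq_sum f (D (f 2))]
    simp only [hsym]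
    rw [hcomm 0 1] at s01
    rw [hcomm 0 1, hcomm 0 2, hcomm 1 2]
    set d00 : ℝ := inner ℝ (D (f 0)) (f 0)
    set d10 : ℝ := inner ℝ (D (f 1)) (f 0)
    set d11 : ℝ := inner ℝ (D (f 1)) (f 1)
    set a00 : ℝ := inner ℝ (du (gaussMap x) 0) (f 0)
    set a01 : ℝ := inner ℝ (du (gaussMap x) 0) (f 1)
    set a10 : ℝ := inner ℝ (dv (gaussMap x) 0) (f 0)
    set a11 : ℝ := inner ℝ (dv (gaussMap x) 0) (f 1)
    linear_combination -(d00 ^ 2 + 2 * d10 ^ 2 + d11 ^ 2) * hσ - (‖N‖ * a00 + σ * d00) * s00 -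
      (‖N‖ * a01 + σ * d10) * s01 - (‖N‖ * a10 + σ * d10) * s10 - (‖N‖ * a11 + σ * d11) * s11
  have hw : ‖N‖ ≠ 0 := hW.ne'
  rw [sum_norm_sq_eq hD e f]
  generalize ‖N‖ = W at *
  subst hNf
  simp only [map_smul, norm_smul, inner_smul_left, inner_smul_right, conj_trivial, mul_pow,
    Real.norm_eq_abs, sq_abs]
  linear_combination W ^ 4 * main

end

/-! ### Consequences of the identity for the eigenvalues. -/

lemma exists_third {i j : Fin 3} (hij : i ≠ j) :
    ∃ m, m ≠ i ∧ m ≠ j ∧ ∀ g : Fin 3 → ℝ, ∑ l, g l = g i + g j + g m := by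
  obtain ⟨m, hi, hj⟩ : ∃ m : Fin 3, m ≠ i ∧ m ≠ j := by revert i j; decide
  have hall : ∀ l, l = i ∨ l = j ∨ l = m := by revert i j m; decide
  refine ⟨m, hi, hj, fun g => ?_⟩
  have : (Finset.univ : Finset (Fin 3)) = {i, j, m} := by
    ext l; simpa using hall l
  rw [this, Finset.sum_insert (by simp [hij, hi.symm]), Finset.sum_pair hj.symm, add_assoc]

/-- If `w² τ - 2 w m + q² = w² l` holds for affine functions `w`, `m`, `q`, `l` of one variable on
an interval, then `q` vanishes at the zeros of `w`, inside the interval or not. -/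
lemma affine_eq_zero_of_identity {δ τ w0 w1 m0 m1 q0 q1 l0 l1 : ℝ} (hδ : 0 < δ)
    (h : ∀ s, 0 ≤ s → s ≤ δ → (w0 + w1 * s) ^ 2 * τ - 2 * (w0 + w1 * s) * (m0 + m1 * s) +
      (q0 + q1 * s) ^ 2 = (w0 + w1 * s) ^ 2 * (l0 + l1 * s)) {s : ℝ} (hs : w0 + w1 * s = 0) :
    q0 + q1 * s = 0 := by
  have h0 := h 0 le_rfl hδ.le
  have h1 := h (δ / 3) (by positivity) (by linarith)
  have h2 := h (2 * (δ / 3)) (by positivity) (by linarith)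
  have h3 := h (3 * (δ / 3)) (by positivity) (by linarith)
  have hε : δ / 3 ≠ 0 := by positivity
  set ε := δ / 3
  -- the coefficients of the cubic polynomial, from its values at `0`, `ε`, `2 ε`, `3 ε`
  obtain ⟨c0, hc0⟩ : ∃ c, c = w0 ^ 2 * τ - 2 * w0 * m0 + q0 ^ 2 - w0 ^ 2 * l0 := ⟨_, rfl⟩
  obtain ⟨c1, hc1⟩ : ∃ c, c = 2 * w0 * w1 * τ - 2 * (w0 * m1 + w1 * m0) + 2 * q0 * q1 -
    (w0 ^ 2 * l1 + 2 * w0 * w1 * l0) := ⟨_, rfl⟩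
  obtain ⟨c2, hc2⟩ : ∃ c, c = w1 ^ 2 * τ - 2 * w1 * m1 + q1 ^ 2 -
    (2 * w0 * w1 * l1 + w1 ^ 2 * l0) := ⟨_, rfl⟩
  obtain ⟨c3, hc3⟩ : ∃ c, c = -(w1 ^ 2 * l1) := ⟨_, rfl⟩
  have p0 : c0 = 0 := by rw [hc0]; linear_combination h0
  have p1 : c0 + c1 * ε + c2 * ε ^ 2 + c3 * ε ^ 3 = 0 := by
    rw [hc0, hc1, hc2, hc3]; linear_combination h1
  have p2 : c0 + c1 * (2 * ε) + c2 * (2 * ε) ^ 2 + c3 * (2 * ε) ^ 3 = 0 := by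
    rw [hc0, hc1, hc2, hc3]; linear_combination h2
  have p3 : c0 + c1 * (3 * ε) + c2 * (3 * ε) ^ 2 + c3 * (3 * ε) ^ 3 = 0 := by
    rw [hc0, hc1, hc2, hc3]; linear_combination h3
  have z3 : c3 = 0 := by
    have : c3 * ε ^ 3 = 0 := by linear_combination (p3 - 3 * p2 + 3 * p1 - p0) / 6
    exact (mul_eq_zero.1 this).resolve_right (pow_ne_zero _ hε)
  have z2 : c2 = 0 := by
    have : c2 * ε ^ 2 = 0 := by linear_combination (p2 - 2 * p1 + p0) / 2 - 3 * ε ^ 3 * z3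
    exact (mul_eq_zero.1 this).resolve_right (pow_ne_zero _ hε)
  have z1 : c1 = 0 := by
    have : c1 * ε = 0 := by linear_combination p1 - p0 - ε ^ 2 * z2 - ε ^ 3 * z3
    exact (mul_eq_zero.1 this).resolve_right hε
  -- A cubic with four zeros vanishes identically; at a zero of `w` every term but `q²` disappears.
  have : (q0 + q1 * s) ^ 2 = 0 := by
    linear_combination p0 + s * z1 + s ^ 2 * z2 + s ^ 3 * z3 - hc0 - s * hc1 - s ^ 2 * hc2 -
      s ^ 3 * hc3 + (-(w0 + w1 * s) * τ + 2 * (m0 + m1 * s) + (w0 + w1 * s) * (l0 + l1 * s)) * hs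
  exact pow_eq_zero_iff two_ne_zero |>.1 this

section

variable {D : E3 →L[ℝ] E3} {b : E3} {c : ℝ} {Λ : Matrix (Fin 3) (Fin 3) ℝ}
  {e : OrthonormalBasis (Fin 3) ℝ E3} {lam : Fin 3 → ℝ} {a : E3}

lemma inner_basis_self (e : OrthonormalBasis (Fin 3) ℝ E3) (i : Fin 3) :
    (inner ℝ (e i) (e i) : ℝ) = 1 := by simp

lemma inner_basis_ne (e : OrthonormalBasis (Fin 3) ℝ E3) {i j : Fin 3} (h : i ≠ j) :
    (inner ℝ (e i) (e j) : ℝ) = 0 := e.orthonormal.2 h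

lemma sum_norm_eigen (he : ∀ i, D (e i) = lam i • e i) :
    ∑ i, ‖D (e i)‖ ^ 2 = ∑ i, lam i ^ 2 :=
  Finset.sum_congr rfl fun i _ => by simp [he, norm_smul]

/-- If the gradient `ℓ` at `a` were nonzero, it would lie in `ker D`, and the section along `e i`
and `ℓ` would be a parabola with `N = X e i + ℓ`. Then `|N|² = X² + |ℓ|²` and `⟨D N, N⟩ = lam i X²`
have no common zero in `X²`. -/
lemma linear_part_eq_zero (hD : ∀ y z, (inner ℝ (D y) z : ℝ) = inner ℝ y (D z))
    (hΛ : GaussMapSatisfies {y | quadPoly D b c y = 0} Λ) (he : ∀ i, D (e i) = lam i • e i)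
    (ha : D (D a + b) = 0) {i : Fin 3} (hi : lam i ≠ 0) : D a + b = 0 := by
  by_contra hℓ
  set ℓ := D a + b with hℓ'
  set M := Matrix.toEuclideanCLM (𝕜 := ℝ) Λ
  have hL : 0 < ‖ℓ‖ ^ 2 := by have := norm_pos_iff.2 hℓ; positivity
  have hℓe : (inner ℝ ℓ (e i) : ℝ) = 0 := by
    have h1 := hD ℓ (e i)
    rw [ha, he, inner_smul_right, inner_zero_left] at h1
    exact (mul_eq_zero.1 h1.symm).resolve_left hi
  have heℓ : (inner ℝ (e i) ℓ : ℝ) = 0 := by rw [real_inner_comm, hℓe]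
  have hee := inner_basis_self e i
  have key : ∀ X : ℝ, (X ^ 2 + ‖ℓ‖ ^ 2) ^ 2 * ∑ i, lam i ^ 2 -
      2 * (X ^ 2 + ‖ℓ‖ ^ 2) * (lam i ^ 2 * X ^ 2) + (lam i * X ^ 2) ^ 2 =
      (X ^ 2 + ‖ℓ‖ ^ 2) ^ 2 * (X ^ 2 * inner ℝ (e i) (M (e i)) +
        X * (inner ℝ (e i) (M ℓ) + inner ℝ ℓ (M (e i))) + inner ℝ ℓ (M ℓ)) := fun X => by
    set s := X / lam i
    set t := -(quadPoly D b c a + lam i * s ^ 2 / 2) / ‖ℓ‖ ^ 2 with ht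
    have hX : lam i * s = X := mul_div_cancel₀ _ hi
    have hp : quadPoly D b c (a + (s • e i + t • ℓ)) = 0 := by
      rw [quadPoly_add hD, ← hℓ']
      simp only [map_add, map_smul, he, ha, inner_add_left, inner_add_right, inner_smul_left,
        inner_smul_right, hℓe, heℓ, hee, conj_trivial, real_inner_self_eq_norm_sq ℓ, smul_zero,
        inner_zero_left]
      rw [ht]; field_simp; ring
    have hN : D (a + (s • e i + t • ℓ)) + b = X • e i + ℓ := by
      rw [map_add, map_add, map_smul, map_smul, ha, he, smul_smul, mul_comm s, hX, smul_zero,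
        hℓ']
      abel
    have hw : ‖X • e i + ℓ‖ ^ 2 = X ^ 2 + ‖ℓ‖ ^ 2 := by
      rw [← real_inner_self_eq_norm_sq, ← real_inner_self_eq_norm_sq]
      simp only [inner_add_left, inner_add_right, inner_smul_left,
        inner_smul_right, hℓe, heℓ, hee, conj_trivial]
      ring
    have hN0 : X • e i + ℓ ≠ 0 := fun h0 => by
      rw [h0] at hw; simp at hw; nlinarith [sq_nonneg X]
    have := hΛ.quadPoly_identity hD e hp hN hN0
    rw [sum_norm_eigen he, hw] at this
    rw [← real_inner_self_eq_norm_sq (D _)] at this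
    simp only [map_add, map_smul, he, ha, inner_add_left, inner_add_right, inner_smul_left,
        inner_smul_right, heℓ, hee, conj_trivial, add_zero] at this
    linear_combination this
  -- The variable is `X²`; averaging over `X` and `-X` cancels the odd terms coming from `Λ`.
  have := affine_eq_zero_of_identity (δ := 1) (τ := ∑ i, lam i ^ 2) (w0 := ‖ℓ‖ ^ 2) (w1 := 1)
    (m0 := 0) (m1 := lam i ^ 2) (q0 := 0) (q1 := lam i) (l0 := inner ℝ ℓ (M ℓ))
    (l1 := inner ℝ (e i) (M (e i))) one_pos (fun s hs _ => by
      have h1 := key (√s)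
      have h2 := key (-√s)
      simp only [neg_sq, Real.sq_sqrt hs] at h1 h2
      linear_combination (h1 + h2) / 2) (s := -‖ℓ‖ ^ 2) (by ring)
  simp [hi, hL.ne'] at this

/-- The section through the centre along `e i` and `e j` is the conic `X²/lam i + Y²/lam j = K`,
with `N = X e i + Y e j`. The sign hypothesis says that it meets the `e i` axis in real points, so
`Y²` ranges over an interval starting at 0. -/
lemma eigenvalue_eq (hD : ∀ y z, (inner ℝ (D y) z : ℝ) = inner ℝ y (D z))
    (hΛ : GaussMapSatisfies {y | quadPoly D b c y = 0} Λ) (he : ∀ i, D (e i) = lam i • e i)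
    (ha : D a + b = 0) {i j : Fin 3} (hij : i ≠ j) (hi : lam i * quadPoly D b c a < 0)
    (hj : lam j ≠ 0) : lam j = lam i := by
  by_contra hne
  set M := Matrix.toEuclideanCLM (𝕜 := ℝ) Λ
  obtain ⟨K, hK⟩ : ∃ K, K = -2 * quadPoly D b c a := ⟨_, rfl⟩
  have hiK : 0 < lam i * K := by rw [hK]; linarith
  have hi0 : lam i ≠ 0 := left_ne_zero_of_mul hiK.ne'
  have hK0 : K ≠ 0 := right_ne_zero_of_mul hiK.ne'
  have hii := inner_basis_self e i
  have hjj := inner_basis_self e j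
  have hij' := inner_basis_ne e hij
  have hji' := inner_basis_ne e hij.symm
  have key : ∀ X Y : ℝ, X ^ 2 / lam i + Y ^ 2 / lam j = K →
      (X ^ 2 + Y ^ 2) ^ 2 * ∑ i, lam i ^ 2 -
      2 * (X ^ 2 + Y ^ 2) * (lam i ^ 2 * X ^ 2 + lam j ^ 2 * Y ^ 2) +
        (lam i * X ^ 2 + lam j * Y ^ 2) ^ 2 =
      (X ^ 2 + Y ^ 2) ^ 2 * (X ^ 2 * inner ℝ (e i) (M (e i)) +
        X * Y * (inner ℝ (e i) (M (e j)) + inner ℝ (e j) (M (e i))) +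
        Y ^ 2 * inner ℝ (e j) (M (e j))) := fun X Y hXY => by
    have hp : quadPoly D b c (a + ((X / lam i) • e i + (Y / lam j) • e j)) = 0 := by
      rw [quadPoly_add hD, ha]
      simp only [map_add, map_smul, he, inner_add_left, inner_add_right, inner_smul_left,
        inner_smul_right, hii, hjj, hij', hji', conj_trivial, inner_zero_left]
      have h1 : X / lam i * (X / lam i * (lam i * 1)) = X ^ 2 / lam i := by field_simp
      have h2 : Y / lam j * (Y / lam j * (lam j * 1)) = Y ^ 2 / lam j := by field_simp
      linear_combination (hXY + hK + h1 + h2) / 2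
    have hN : D (a + ((X / lam i) • e i + (Y / lam j) • e j)) + b = X • e i + Y • e j := by
      rw [map_add, map_add, map_smul, map_smul, he, he, smul_smul, smul_smul,
        div_mul_cancel₀ _ hi0, div_mul_cancel₀ _ hj, eq_neg_of_add_eq_zero_left ha]
      abel
    have hw : ‖X • e i + Y • e j‖ ^ 2 = X ^ 2 + Y ^ 2 := by
      rw [← real_inner_self_eq_norm_sq]
      simp only [inner_add_left, inner_add_right, inner_smul_left,
        inner_smul_right, hii, hjj, hij', hji', conj_trivial]
      ring
    have hN0 : X • e i + Y • e j ≠ 0 := fun h0 => by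
      rw [h0] at hw
      have hX : X ^ 2 = 0 := by simp at hw; nlinarith [sq_nonneg X, sq_nonneg Y]
      have hY : Y ^ 2 = 0 := by simp at hw; nlinarith [sq_nonneg X, sq_nonneg Y]
      rw [hX, hY] at hXY
      simp at hXY; exact hK0 hXY.symm
    have := hΛ.quadPoly_identity hD e hp hN hN0
    rw [sum_norm_eigen he, hw] at this
    rw [← real_inner_self_eq_norm_sq (D _)] at this
    simp only [map_add, map_smul, he, inner_add_left, inner_add_right, inner_smul_left,
        inner_smul_right, hii, hjj, hij', hji', conj_trivial] at this
    linear_combination this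
  set α := lam i
  set β := lam j
  have hαβ : α - β ≠ 0 := sub_ne_zero.2 fun h => hne h.symm
  -- With `s = Y²` and `X² = α K - (α / β) s`, the bound `s ≤ |β K|` keeps `X²` nonnegative. For `α
  -- ≠ β`, `|N|²` vanishes at `s = α β K / (α - β)`, where `⟨D N, N⟩ = -α β K ≠ 0`.
  have := affine_eq_zero_of_identity (δ := |β * K|) (τ := ∑ i, lam i ^ 2) (w0 := α * K)
    (w1 := 1 - α / β) (m0 := α ^ 2 * (α * K)) (m1 := β ^ 2 - α ^ 2 * (α / β))
    (q0 := α * (α * K)) (q1 := β - α * (α / β))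
    (l0 := α * K * inner ℝ (e i) (M (e i)))
    (l1 := inner ℝ (e j) (M (e j)) - α / β * inner ℝ (e i) (M (e i)))
    (abs_pos.2 (mul_ne_zero hj hK0)) (fun s hs hsδ => by
      have hX : 0 ≤ α * K - α / β * s := by
        have h1 : α / β * s = α * K * (s / (β * K)) := by field_simp
        have h2 : s / (β * K) ≤ 1 := by
          refine (le_abs_self _).trans ?_
          rw [abs_div, abs_of_nonneg hs]
          exact div_le_one_of_le₀ hsδ (abs_nonneg _)
        rw [h1]; nlinarith
      have hXY : (α * K - α / β * s) / α + s / β = K := by field_simp; ring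
      have h1 := key √(α * K - α / β * s) √s (by rw [Real.sq_sqrt hX, Real.sq_sqrt hs, hXY])
      have h2 := key (-√(α * K - α / β * s)) √s
        (by rw [neg_sq, Real.sq_sqrt hX, Real.sq_sqrt hs, hXY])
      simp only [neg_sq, Real.sq_sqrt hs, Real.sq_sqrt hX] at h1 h2
      linear_combination (h1 + h2) / 2) (s := α * β * K / (α - β)) (by field_simp; ring)
  have h2 : α * (α * K) + (β - α * (α / β)) * (α * β * K / (α - β)) = -(α * β * K) := by
    field_simp; ring
  rw [h2] at this
  simp [hi0, hj, hK0, α, β] at this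

/-- Along a ruling through the vertex, `N` scales by `r` and the two sides of the identity have
degrees 4 and 6 in `r`. Both therefore vanish, and the left side is a sum of two squares, one of
them `(lam m |N|²)²`. -/
lemma cone_third_eigenvalue_eq_zero (hD : ∀ y z, (inner ℝ (D y) z : ℝ) = inner ℝ y (D z))
    (hΛ : GaussMapSatisfies {y | quadPoly D b c y = 0} Λ) (he : ∀ i, D (e i) = lam i • e i)
    (ha : D a + b = 0) (hk : quadPoly D b c a = 0) {i j m : Fin 3}
    (hi : 0 < lam i) (hj : lam j < 0)
    (hm : ∀ g : Fin 3 → ℝ, ∑ l, g l = g i + g j + g m) : lam m = 0 := by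
  have hij : i ≠ j := fun h => by rw [h] at hi; linarith
  set M := Matrix.toEuclideanCLM (𝕜 := ℝ) Λ
  have hii := inner_basis_self e i
  have hjj := inner_basis_self e j
  have hij' := inner_basis_ne e hij
  have hji' := inner_basis_ne e hij.symm
  set s := √(-lam j)
  set t := √(lam i)
  have hs : s ^ 2 = -lam j := Real.sq_sqrt (by linarith)
  have ht : t ^ 2 = lam i := Real.sq_sqrt hi.le
  have ht0 : 0 < t := Real.sqrt_pos.2 hi
  obtain ⟨X, hX⟩ : ∃ X, X = lam i * s := ⟨_, rfl⟩
  obtain ⟨Y, hY⟩ : ∃ Y, Y = lam j * t := ⟨_, rfl⟩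
  have hY0 : Y ≠ 0 := by rw [hY]; exact mul_ne_zero hj.ne ht0.ne'
  have hw : ‖X • e i + Y • e j‖ ^ 2 = X ^ 2 + Y ^ 2 := by
    rw [← real_inner_self_eq_norm_sq]
    simp only [inner_add_left, inner_add_right, inner_smul_left,
      inner_smul_right, hii, hjj, hij', hji', conj_trivial]
    ring
  have hYpos : 0 < Y ^ 2 := by positivity
  have hN0 : X • e i + Y • e j ≠ 0 := fun h0 => by
    rw [h0] at hw
    simp at hw; nlinarith [sq_nonneg X]
  have key : ∀ r : ℝ, r ≠ 0 → _ := fun r hr => by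
    have hp : quadPoly D b c (a + r • (s • e i + t • e j)) = 0 := by
      rw [quadPoly_add hD, ha, hk]
      simp only [map_add, map_smul, he, inner_add_left, inner_add_right, inner_smul_left,
        inner_smul_right, hii, hjj, hij', hji', conj_trivial, inner_zero_left]
      linear_combination (r ^ 2 * lam i / 2) * hs + (r ^ 2 * lam j / 2) * ht
    have hN : D (a + r • (s • e i + t • e j)) + b = r • (X • e i + Y • e j) := by
      rw [map_add, map_smul, map_add, map_smul, map_smul, he, he, smul_smul, smul_smul,
        mul_comm s, mul_comm t, ← hX, ← hY, eq_neg_of_add_eq_zero_left ha]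
      abel
    exact hΛ.quadPoly_identity hD e hp hN (smul_ne_zero hr hN0)
  have h1 := key 1 one_ne_zero
  have h2 := key 2 two_ne_zero
  simp only [norm_smul, mul_pow, hw, map_smul] at h1 h2
  rw [← real_inner_self_eq_norm_sq (D _)] at h1 h2
  rw [sum_norm_eigen he, hm] at h1 h2
  simp only [map_add, map_smul, he, inner_add_left, inner_add_right, inner_smul_left,
    inner_smul_right, hii, hjj, hij', hji', conj_trivial] at h1 h2
  norm_num at h1 h2
  -- The values at `r = 1` and `r = 2` are combined so that the degree 6 side cancels.
  have h3 : (lam m * (X ^ 2 + Y ^ 2)) ^ 2 + (lam i * Y ^ 2 + lam j * X ^ 2) ^ 2 = 0 := by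
    linear_combination (4 / 3 : ℝ) * h1 - (1 / 48 : ℝ) * h2
  have h4 : (lam m * (X ^ 2 + Y ^ 2)) ^ 2 = 0 := by
    nlinarith [sq_nonneg (lam m * (X ^ 2 + Y ^ 2)), sq_nonneg (lam i * Y ^ 2 + lam j * X ^ 2)]
  have h5 := pow_eq_zero_iff two_ne_zero |>.1 h4
  refine (mul_eq_zero.1 h5).resolve_right (by positivity)

end

/-- No regular patch lies in the intersection of two different coordinate planes. -/
lemma IsRegularPatch.false_of_subset_line {S : Set E3} {U : Set (ℝ × ℝ)} {x : ℝ × ℝ → E3}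
    (h : IsRegularPatch S U x) (hU : U.Nonempty) (e : OrthonormalBasis (Fin 3) ℝ E3) {a : E3}
    {i j : Fin 3} (hij : i ≠ j) (hi : ∀ y ∈ S, inner ℝ (e i) (y - a) = (0 : ℝ))
    (hj : ∀ y ∈ S, inner ℝ (e j) (y - a) = (0 : ℝ)) : False := by
  obtain ⟨p, hp⟩ := hU
  obtain ⟨m, -, -, hm⟩ := exists_third hij
  have hd := (h.contDiffAt hp).differentiableAt_infty
  have key : ∀ l, (∀ y ∈ S, inner ℝ (e l) (y - a) = (0 : ℝ)) →
      (inner ℝ (e l) (du x p) : ℝ) = 0 ∧ (inner ℝ (e l) (dv x p) : ℝ) = 0 := fun l hl => by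
    have hc : (fun q => innerSL ℝ (e l) (x q)) =ᶠ[nhds p] fun _ => (inner ℝ (e l) a : ℝ) := by
      filter_upwards [h.eventually_mem hp] with q hq
      have := hl _ (h.mapsTo hq)
      rw [inner_sub_right] at this
      simpa using sub_eq_zero.1 this
    have h1 := du_congr hc
    have h2 := dv_congr hc
    rw [du_clm _ hd] at h1
    rw [dv_clm _ hd] at h2
    exact ⟨by simpa [du] using h1, by simpa [dv] using h2⟩
  -- Both coordinate vectors are multiples of `e m`, so their Gram determinant is zero.
  have inner_eq : ∀ y z : E3, (inner ℝ (e i) y : ℝ) = 0 → (inner ℝ (e j) y : ℝ) = 0 →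
      (inner ℝ y z : ℝ) = inner ℝ (e m) y * inner ℝ (e m) z := fun y z h1 h2 => by
    rw [← e.sum_inner_mul_inner, hm, real_inner_comm (e i) y, h1, real_inner_comm (e j) y, h2,
      real_inner_comm (e m) y]
    ring
  obtain ⟨iu, iv⟩ := key i hi
  obtain ⟨ju, jv⟩ := key j hj
  refine h.regular p hp (norm_eq_zero.1 (pow_eq_zero_iff two_ne_zero |>.1 ?_))
  rw [norm_cross_sq, inner_eq _ _ iu ju, inner_eq _ _ iv jv, inner_eq _ _ iu ju]
  ring

/-! ### Classification by the value at the centre. -/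

section

variable {D : E3 →L[ℝ] E3} {b : E3} {c : ℝ} {Λ : Matrix (Fin 3) (Fin 3) ℝ}
  {e : OrthonormalBasis (Fin 3) ℝ E3} {lam : Fin 3 → ℝ} {a : E3}

/-- Taylor expansion at the centre `a`, where the gradient vanishes. -/
lemma quadPoly_eq_sum (hD : ∀ y z, (inner ℝ (D y) z : ℝ) = inner ℝ y (D z))
    (he : ∀ i, D (e i) = lam i • e i) (ha : D a + b = 0) (y : E3) :
    quadPoly D b c y = quadPoly D b c a + (∑ i, lam i * inner ℝ (e i) (y - a) ^ 2) / 2 := by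
  have h1 : (inner ℝ (D (y - a)) (y - a) : ℝ) = ∑ i, lam i * inner ℝ (e i) (y - a) ^ 2 := by
    rw [← e.sum_inner_mul_inner]
    refine Finset.sum_congr rfl fun i _ => ?_
    rw [hD, he, inner_smul_right, real_inner_comm]
    ring
  rw [← h1]
  conv_lhs => rw [← add_sub_cancel a y]
  rw [quadPoly_add hD, ha, inner_zero_left, add_zero]

lemma isPlane_inner_sub {v : E3} (hv : v ≠ 0) (a : E3) (d : ℝ) :
    IsPlane {y | inner ℝ v (y - a) = d} := by
  refine ⟨v, d + inner ℝ v a, hv, ?_⟩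
  ext y
  simp [inner_sub_right, sub_eq_iff_eq_add]

lemma isSphere_or_isCircularCylinder_of_ne_zero
    (hD : ∀ y z, (inner ℝ (D y) z : ℝ) = inner ℝ y (D z)) {S : Set E3}
    (hS : S = {y | quadPoly D b c y = 0}) (hΛ : GaussMapSatisfies S Λ)
    (hpair : ¬ ∃ P Q : Set E3, IsPlane P ∧ IsPlane Q ∧ P ≠ Q ∧ S = P ∪ Q)
    (hne : S.Nonempty)
    (he : ∀ i, D (e i) = lam i • e i) (ha : D a + b = 0) (hk : quadPoly D b c a ≠ 0) :
    IsCircularCylinder S ∨ IsSphere S := by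
  -- Otherwise the quadratic part never has the sign opposite to the value at `a`, and the zero set
  -- is empty.
  obtain ⟨i, hi⟩ : ∃ i, lam i * quadPoly D b c a < 0 := by
    by_contra! hcon
    obtain ⟨y, hy⟩ := hne
    rw [hS, Set.mem_ofPred_eq, quadPoly_eq_sum hD he ha] at hy
    have h1 : 0 ≤ quadPoly D b c a * ∑ i, lam i * inner ℝ (e i) (y - a) ^ 2 := by
      rw [Finset.mul_sum]
      refine Finset.sum_nonneg fun i _ => ?_
      nlinarith [mul_nonneg (hcon i) (sq_nonneg (inner ℝ (e i) (y - a) : ℝ))]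
    have h2 : 0 < quadPoly D b c a ^ 2 := by positivity
    rw [eq_neg_of_add_eq_zero_right hy |> fun h => (div_eq_iff two_ne_zero).1 h] at h1
    nlinarith
  rw [hS] at hΛ
  have heq : ∀ j, i ≠ j → lam j = 0 ∨ lam j = lam i := fun j hij =>
    or_iff_not_imp_left.2 (eigenvalue_eq hD hΛ he ha hij hi)
  obtain ⟨j, hij⟩ : ∃ j : Fin 3, i ≠ j := ⟨i + 1, by simp⟩
  obtain ⟨m, hmi, -, hsum⟩ := exists_third hij
  have hi0 : lam i ≠ 0 := left_ne_zero_of_mul hi.ne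
  obtain ⟨r, hr0, hr⟩ : ∃ r : ℝ, 0 < r ∧ lam i * r ^ 2 = -2 * quadPoly D b c a := by
    have h0 : 0 < -2 * quadPoly D b c a / lam i := by
      have h1 : -2 * quadPoly D b c a / lam i = -2 * (lam i * quadPoly D b c a) / lam i ^ 2 := by
        field_simp
      rw [h1]
      have : 0 < lam i ^ 2 := by positivity
      exact div_pos (by linarith) this
    refine ⟨√(-2 * quadPoly D b c a / lam i), Real.sqrt_pos.2 h0, ?_⟩
    rw [Real.sq_sqrt h0.le]
    field_simp
  have hmem : ∀ y, y ∈ S ↔ lam i * inner ℝ (e i) (y - a) ^ 2 + lam j * inner ℝ (e j) (y - a) ^ 2 +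
      lam m * inner ℝ (e m) (y - a) ^ 2 = lam i * r ^ 2 := fun y => by
    rw [hS, Set.mem_ofPred_eq, quadPoly_eq_sum hD he ha, hsum, hr]
    constructor <;> intro h <;> linarith
  have hnorm : ∀ y : E3, ‖y‖ ^ 2 = inner ℝ (e i) y ^ 2 + inner ℝ (e j) y ^ 2 +
      inner ℝ (e m) y ^ 2 := fun y => by
    rw [← e.sum_sq_inner_right, hsum]
  have cyl : ∀ n : Fin 3, (∀ y, y ∈ S ↔ ‖y - a‖ ^ 2 - inner ℝ (e n) (y - a) ^ 2 = r ^ 2) →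
      IsCircularCylinder S := fun n hn => by
    refine ⟨a, e n, r, e.orthonormal.1 n, hr0, ?_⟩
    ext y
    have h1 : ‖y - a - (inner ℝ (e n) (y - a) : ℝ) • e n‖ ^ 2 =
        ‖y - a‖ ^ 2 - inner ℝ (e n) (y - a) ^ 2 := by
      rw [norm_sub_sq_real, inner_smul_right, norm_smul, e.orthonormal.1 n,
        real_inner_comm (e n)]
      simp only [Real.norm_eq_abs, mul_one, sq_abs]
      ring
    rw [hn, Set.mem_ofPred_eq, ← h1, sq_eq_sq₀ (norm_nonneg _) hr0.le]
  -- Each remaining eigenvalue is 0 or `lam i`: both 0 gives two parallel planes, exactly one 0 a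
  -- cylinder along that direction, none a sphere.
  rcases heq j hij with hj | hj <;> rcases heq m hmi.symm with hm | hm
  · refine (hpair ⟨{y | inner ℝ (e i) (y - a) = r}, {y | inner ℝ (e i) (y - a) = -r},
      isPlane_inner_sub (e.orthonormal.ne_zero i) a r,
      isPlane_inner_sub (e.orthonormal.ne_zero i) a (-r), fun h => ?_, ?_⟩).elim
    · have h1 : a + r • e i ∈ {y : E3 | inner ℝ (e i) (y - a) = r} := by
        simp [inner_smul_right]
      rw [h] at h1
      simp [inner_smul_right] at h1
      linarith
    · ext y
      rw [hmem, hj, hm, Set.mem_union, Set.mem_ofPred_eq,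
        Set.mem_ofPred_eq, ← sq_eq_sq_iff_eq_or_eq_neg]
      simp [hi0]
  · refine Or.inl (cyl j fun y => ?_)
    rw [hmem, hnorm, hj, hm]
    exact ⟨fun h => mul_left_cancel₀ hi0 (by linear_combination h), fun h => by
      linear_combination lam i * h⟩
  · refine Or.inl (cyl m fun y => ?_)
    rw [hmem, hnorm, hj, hm]
    exact ⟨fun h => mul_left_cancel₀ hi0 (by linear_combination h), fun h => by
      linear_combination lam i * h⟩
  · refine Or.inr ⟨a, r, hr0, ?_⟩
    ext y
    rw [hmem, hj, hm, mem_sphere_iff_norm, ← sq_eq_sq₀ (norm_nonneg _) hr0.le, hnorm]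
    exact ⟨fun h => mul_left_cancel₀ hi0 (by linear_combination h), fun h => by
      linear_combination lam i * h⟩

/-- With mixed signs the third eigenvalue is 0 and the form factors into two crossing planes. A
semidefinite form vanishes only where all coordinates with nonzero eigenvalue do, and room for a
patch leaves one such coordinate. -/
lemma isPlane_of_eq_zero (hD : ∀ y z, (inner ℝ (D y) z : ℝ) = inner ℝ y (D z)) {S : Set E3}
    (hS : S = {y | quadPoly D b c y = 0}) (hΛ : GaussMapSatisfies S Λ)
    (hpair : ¬ ∃ P Q : Set E3, IsPlane P ∧ IsPlane Q ∧ P ≠ Q ∧ S = P ∪ Q)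
    (hpatch : ∃ (U : Set (ℝ × ℝ)) (x : ℝ × ℝ → E3), U.Nonempty ∧ IsRegularPatch S U x)
    (he : ∀ i, D (e i) = lam i • e i) (ha : D a + b = 0) (hk : quadPoly D b c a = 0)
    (hlam : ∃ i, lam i ≠ 0) : IsPlane S := by
  have hmem : ∀ y, y ∈ S ↔ ∑ i, lam i * inner ℝ (e i) (y - a) ^ 2 = 0 := fun y => by
    rw [hS, Set.mem_ofPred_eq, quadPoly_eq_sum hD he ha, hk]
    constructor <;> intro h <;> linarith
  by_cases hsign : ∃ i j, 0 < lam i ∧ lam j < 0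
  · obtain ⟨i, j, hi, hj⟩ := hsign
    have hij : i ≠ j := fun h => by rw [h] at hi; linarith
    obtain ⟨m, -, -, hsum⟩ := exists_third hij
    have hm : lam m = 0 :=
      cone_third_eigenvalue_eq_zero hD (hS ▸ hΛ) he ha hk hi hj hsum
    obtain ⟨α, hα0, hα⟩ : ∃ α : ℝ, 0 < α ∧ α ^ 2 = lam i :=
      ⟨√(lam i), Real.sqrt_pos.2 hi, Real.sq_sqrt hi.le⟩
    obtain ⟨β, hβ0, hβ⟩ : ∃ β : ℝ, 0 < β ∧ β ^ 2 = -lam j :=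
      ⟨√(-lam j), Real.sqrt_pos.2 (by linarith), Real.sq_sqrt (by linarith)⟩
    have hii := inner_basis_self e i
    have hjj := inner_basis_self e j
    have hij' := inner_basis_ne e hij
    have hji' := inner_basis_ne e hij.symm
    have hne : ∀ γ : ℝ, α • e i + γ • e j ≠ 0 := fun γ h => by
      have := congrArg (fun z => (inner ℝ (e i) z : ℝ)) h
      simp only [inner_add_right, inner_smul_right, hii, hij', inner_zero_right] at this
      linarith
    refine (hpair ⟨{y | inner ℝ (α • e i + β • e j) (y - a) = 0},
      {y | inner ℝ (α • e i + (-β) • e j) (y - a) = 0}, isPlane_inner_sub (hne _) a 0,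
      isPlane_inner_sub (hne _) a 0, fun h => ?_, ?_⟩).elim
    -- The direction `β e i - α e j` lies in the first plane but not in the second.
    · have h1 : a + (β • e i + (-α) • e j) ∈
          {y : E3 | inner ℝ (α • e i + β • e j) (y - a) = 0} := by
        simp only [Set.mem_ofPred_eq, add_sub_cancel_left, inner_add_left, inner_add_right,
          inner_smul_left, inner_smul_right, hii, hjj, hij', hji', conj_trivial]
        ring
      rw [h] at h1
      simp only [Set.mem_ofPred_eq, add_sub_cancel_left, inner_add_left, inner_add_right,
          inner_smul_left, inner_smul_right, hii, hjj, hij', hji', conj_trivial] at h1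
      nlinarith [mul_pos hα0 hβ0]
    · ext y
      rw [hmem, hsum, hm, Set.mem_union, Set.mem_ofPred_eq, Set.mem_ofPred_eq, ← mul_eq_zero]
      simp only [inner_add_left, inner_smul_left, conj_trivial]
      rw [← hα, show lam j = -β ^ 2 by linarith]
      constructor <;> intro h <;> linear_combination h
  · have hzero : ∀ y ∈ S, ∀ i, lam i ≠ 0 → (inner ℝ (e i) (y - a) : ℝ) = 0 := fun y hy i hi => by
      rw [hmem] at hy
      have h1 : ∀ l, lam l * (inner ℝ (e l) (y - a) : ℝ) ^ 2 = 0 := by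
        by_cases hpos : ∃ l, 0 < lam l
        · obtain ⟨l₀, hl₀⟩ := hpos
          have hnn : ∀ l, 0 ≤ lam l := fun l => by
            by_contra hl
            exact hsign ⟨l₀, l, hl₀, not_le.1 hl⟩
          have := (Finset.sum_eq_zero_iff_of_nonneg
            fun l _ => mul_nonneg (hnn l) (sq_nonneg _)).1 hy
          exact fun l => this l (Finset.mem_univ l)
        · have := (Finset.sum_eq_zero_iff_of_nonpos fun l _ =>
            mul_nonpos_of_nonpos_of_nonneg (not_lt.1 fun h => hpos ⟨l, h⟩) (sq_nonneg _)).1 hy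
          exact fun l => this l (Finset.mem_univ l)
      simpa [hi] using h1 i
    obtain ⟨i, hi⟩ := hlam
    have hother : ∀ j, j ≠ i → lam j = 0 := fun j hji => by
      by_contra hj
      obtain ⟨U, x, hU, hx⟩ := hpatch
      exact hx.false_of_subset_line hU e hji (fun y hy => hzero y hy j hj)
        (fun y hy => hzero y hy i hi)
    have : S = {y | inner ℝ (e i) (y - a) = (0 : ℝ)} := by
      ext y
      refine ⟨fun hy => hzero y hy i hi, fun hy => (hmem y).2 ?_⟩
      refine Finset.sum_eq_zero fun l _ => ?_
      by_cases hl : l = i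
      · rw [hl, hy]; simp
      · rw [hother l hl, zero_mul]
    rw [this]
    exact isPlane_inner_sub (e.orthonormal.ne_zero i) a 0

end

/-! ### Reduction to principal axes. -/

/-- A quadric is the zero set of a polynomial whose Hessian is diagonal in an orthonormal basis;
its gradient at a suitable point is annihilated by the Hessian. -/
lemma IsQuadric.exists_normal_form {S : Set E3} (h : IsQuadric S) :
    ∃ (D : E3 →L[ℝ] E3) (b : E3) (c : ℝ) (e : OrthonormalBasis (Fin 3) ℝ E3) (lam : Fin 3 → ℝ)
      (a : E3), (∀ y z, (inner ℝ (D y) z : ℝ) = inner ℝ y (D z)) ∧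
      (∀ i, D (e i) = lam i • e i) ∧ (∃ i, lam i ≠ 0) ∧ D (D a + b) = 0 ∧
      S = {y | quadPoly D b c y = 0} := by
  obtain ⟨A, b, c, hA, hA0, rfl⟩ := h
  set D : E3 →L[ℝ] E3 := (2 : ℝ) • Matrix.toEuclideanCLM (𝕜 := ℝ) A with hDdef
  have hDi : ∀ (y : E3) (i : Fin 3), D y i = 2 * ∑ j, A i j * y j := fun y i => rfl
  have hsymm : ∀ i j, A i j = A j i := fun i j => hA.apply j i
  have hD : ∀ y z, (inner ℝ (D y) z : ℝ) = inner ℝ y (D z) := fun y z => by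
    simp only [← sum_mul_eq_inner, hDi, Fin.sum_univ_three]
    rw [hsymm 1 0, hsymm 2 0, hsymm 2 1]
    ring
  have hsym : (D : E3 →ₗ[ℝ] E3).IsSymmetric := hD
  have hfin : Module.finrank ℝ E3 = 3 := by simp
  set e := hsym.eigenvectorBasis hfin
  set lam := hsym.eigenvalues hfin
  have he : ∀ i, D (e i) = lam i • e i := fun i => hsym.apply_eigenvectorBasis hfin i
  have hinner : ∀ i y, (inner ℝ (e i) (D y) : ℝ) = lam i * inner ℝ (e i) y := fun i y => by
    rw [← hD, he, inner_smul_left, conj_trivial]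
  have hext : ∀ y, (∀ i, (inner ℝ (e i) y : ℝ) = 0) → y = 0 := fun y hy => by
    rw [← e.sum_repr' y]
    simp [hy]
  set B : E3 := WithLp.toLp 2 b
  -- Completing the square in each eigendirection. Division by zero gives 0 where `lam i = 0`, so
  -- the gradient at this point keeps only its component in `ker D`.
  refine ⟨D, B, c, e, lam, ∑ i, (-inner ℝ (e i) B / lam i) • e i, hD, he, ?_, ?_, ?_⟩
  · by_contra! hcon
    refine hA0 (Matrix.ext fun i j => ?_)
    have h0 : D (EuclideanSpace.single j 1) = 0 :=
      hext _ fun i => by rw [hinner, hcon, zero_mul]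
    have h1 := hDi (EuclideanSpace.single j 1) i
    rw [h0] at h1
    simpa using h1
  · refine hext _ fun i => ?_
    rw [hinner, inner_add_right, hinner, e.orthonormal.inner_right_fintype]
    by_cases hi : lam i = 0
    · rw [hi, zero_mul]
    · field_simp
      ring
  · ext y
    simp only [Set.mem_ofPred_eq, quadPoly, ← sum_mul_eq_inner, hDi]
    have : (∑ i, (2 * ∑ j, A i j * y j) * y i) / 2 = ∑ i, ∑ j, A i j * y i * y j := by
      simp only [Fin.sum_univ_three]; ring
    rw [this]

end QuadricGauss

/-- A quadric surface in Euclidean 3-space has a Gauss map satisfying `Δ n = Λ n` for some constant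
real `3 × 3` matrix `Λ` if and only if it is a plane, a circular cylinder or a sphere. -/
theorem theorem3 (S : Set QuadricGauss.E3) (hS : QuadricGauss.IsQuadricSurface S) :
    (∃ Λ : Matrix (Fin 3) (Fin 3) ℝ, QuadricGauss.GaussMapSatisfies S Λ) ↔
      (QuadricGauss.IsPlane S ∨ QuadricGauss.IsCircularCylinder S ∨ QuadricGauss.IsSphere S) := by
  constructor
  · rintro ⟨Λ, hΛ⟩
    obtain ⟨D, b, c, e, lam, a, hD, he, ⟨i, hi⟩, ha, hSq⟩ := hS.isQuadric.exists_normal_form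
    have ha' := QuadricGauss.linear_part_eq_zero hD (hSq ▸ hΛ) he ha hi
    by_cases hk : QuadricGauss.quadPoly D b c a = 0
    · exact Or.inl (QuadricGauss.isPlane_of_eq_zero hD hSq hΛ hS.not_pair_of_planes
        hS.exists_patch he ha' hk ⟨i, hi⟩)
    · obtain ⟨U, x, ⟨p, hp⟩, hx⟩ := hS.exists_patch
      exact Or.inr (QuadricGauss.isSphere_or_isCircularCylinder_of_ne_zero hD hSq hΛ
        hS.not_pair_of_planes ⟨x p, hx.mapsTo hp⟩ he ha' hk)
  · rintro (h | h | h)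
    · exact QuadricGauss.gaussMapSatisfies_of_isPlane h
    · exact QuadricGauss.gaussMapSatisfies_of_isCircularCylinder h
    · exact QuadricGauss.gaussMapSatisfies_of_isSphere h
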